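/- Let $K$ be a complete discretely valued field of mixed characteristic with valuation ring $R$, residue field $k$ and uniformiser $\pi$. Rings are associative and unital, modules are left modules. **Deformations.** Let $U$ be a deformable $R$-algebra, i.e. an $R$-algebra with an exhaustive ring filtration $(F_iU)_{i\in\mathbb Z}$ by $R$-submodules, $F_iU=0$ for $i<0$, such that $\operatorname{gr}U=\bigoplus_i F_iU/F_{i-1}U$ is flat over $R$. Assume that $\operatorname{gr}U$ is commutative and noetherian and that $\bigcap_i\pi^iF_0U=0$. Let $M$ be a finitely generated $\pi$-torsionfree $U$-module. A good filtration of $M$ is an exhaustive filtration $F_\bullet M$ compatible with $F_\bullet U$, with $F_iM=0$ for $i<0$, of the form $F_iM=\sum_{j=1}^r(F_{i-k_j}U)m_j$ for some $m_j\in M$, $k_j\in\mathbb Z$. For $n\ge 0$ put $$U_n=\sum_{j\ge0}\pi^{jn}F_jU,\quad F_iU_n=\sum_{0\le j\le i}\pi^{jn}F_jU,\qquad M_n=\sum_{j\ge0}\pi^{jn}F_jM,\quad F_iM_n=\sum_{0\le j\le i}\pi^{jn}F_jM.$$ Let $\widehat{U_n}$ be the $\pi$-adic completion of $U_n$ and $\widehat{U_{n,K}}=\widehat{U_n}\otimes_RK$;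 it receives a canonical map $U\to U\otimes_RK=U_n\otimes_RK\to\widehat{U_{n,K}}$. **Double filtrations.** An $R$-lattice in a $K$-vector space $V$ is an $R$-submodule $L$ with $K\cdot L=V$ and $\bigcap_i\pi^iL=0$. A doubly filtered $K$-algebra is a $K$-algebra $A$ with an $R$-subalgebra $F_0A$ that is an $R$-lattice and an exhaustive ring filtration on $\operatorname{gr}_0A=F_0A/\pi F_0A$; put $\operatorname{Gr}(A)=\operatorname{gr}(\operatorname{gr}_0A)$. A double filtration on an $A$-module $V$ is an $R$-lattice $F_0V$ that is an $F_0A$-submodule, together with an exhaustive filtration on $\operatorname{gr}_0V=F_0V/\pi F_0V$ compatible with that of $\operatorname{gr}_0A$; put $\operatorname{Gr}(V)=\operatorname{gr}(\operatorname{gr}_0V)$. It is good if the filtration on $\operatorname{gr}_0V$ is separated and $\operatorname{Gr}(V)$ is a finitely generated $\operatorname{Gr}(A)$-module. The algebra $\widehat{U_{n,K}}$ is doubly filtered with lattice $\widehat{U_n}$ and, on the slice $\widehat{U_n}/\pi\widehat{U_n}\cong U_n/\pi U_n$, the images of the $F_iU_n$. **Proposition.** The module $M$ has a good filtration. For every good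 filtration $F_\bullet M$ there is an integer $n_0\ge0$ such that for all $n\ge n_0$ the following hold. 1. The $\widehat{U_{n,K}}$-module $\widehat{U_{n,K}}\otimes_UM$ is finitely generated, and it has a good double filtration whose lattice is the $\widehat{U_n}$-submodule generated by $\{1\otimes m: m\in M_n\}$ and whose filtration on the slice has as $i$-th step the set of classes of the elements $1\otimes m$, $m\in F_iM_n$. 2. There is a graded isomorphism of $k$-algebras $\xi_{n_0,n}:\operatorname{Gr}(\widehat{U_{n_0,K}})\to\operatorname{Gr}(\widehat{U_{n,K}})$ that sends, for $i\ge0$ and $u\in F_iU_{n_0}$, the class of $u$ in degree $i$ to the class of $\pi^{i(n-n_0)}u$ in degree $i$. 3. With the double filtrations of 1., there is a graded $k$-linear isomorphism $$\mu_{n_0,n}:\operatorname{Gr}\bigl(\widehat{U_{n_0,K}}\otimes_UM\bigr)\longrightarrow\operatorname{Gr}\bigl(\widehat{U_{n,K}}\otimes_UM\bigr)$$ that sends, for $i\ge0$ and $m\in F_iM_{n_0}$, the class of $1\otimes m$ in degree $i$ to the class of $1\otimes\pi^{i(n-n_0)}m$ in degree $i$, and $\mu_{n_0,n}(ax)=\xi_{n_0,n}(a)\,\mu_{n_0,n}(x)$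 for all $a\in\operatorname{Gr}(\widehat{U_{n_0,K}})$ and $x\in\operatorname{Gr}(\widehat{U_{n_0,K}}\otimes_UM)$. -/

import Mathlib

open scoped DirectSum TensorProduct Pointwise

noncomputable section GradedDefs

variable {R : Type*} [CommRing R]

/-- The `i`-th graded piece `F_i X / F_{i-1} X` of an increasing family of submodules. -/
def GrPiece {X : Type*} [AddCommGroup X] [Module R X] (F : ℤ → Submodule R X) (i : ℤ) : Type _ :=
  F i ⧸ (F (i - 1)).submoduleOf (F i)

section Pieces

variable {X : Type*} [AddCommGroup X] [Module R X] (F : ℤ → Submodule R X) (i : ℤ)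

instance : AddCommGroup (GrPiece F i) :=
  inferInstanceAs (AddCommGroup (F i ⧸ (F (i - 1)).submoduleOf (F i)))

instance : Module R (GrPiece F i) :=
  inferInstanceAs (Module R (F i ⧸ (F (i - 1)).submoduleOf (F i)))

/-- The class in `F_i X / F_{i-1} X` of an element of `F_i X`. -/
def GrPiece.mk : F i →ₗ[R] GrPiece F i := ((F (i - 1)).submoduleOf (F i)).mkQ

theorem GrPiece.mk_surjective : Function.Surjective (GrPiece.mk F i) :=
  Submodule.mkQ_surjective _

theorem GrPiece.mk_eq_zero (x : F i) : GrPiece.mk F i x = 0 ↔ (x : X) ∈ F (i - 1) :=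
  (Submodule.Quotient.mk_eq_zero _).trans Iff.rfl

theorem GrPiece.sigma_ext {i j : ℤ} (h : i = j) (x : F i) (y : F j) (hxy : (x : X) = y) :
    (⟨i, GrPiece.mk F i x⟩ : GradedMonoid (GrPiece F)) = ⟨j, GrPiece.mk F j y⟩ := by
  subst h
  rw [Subtype.ext hxy]

end Pieces

/-- The associated graded module `⨁ F_i X / F_{i-1} X`. -/
abbrev Gr {X : Type*} [AddCommGroup X] [Module R X] (F : ℤ → Submodule R X) : Type _ :=
  ⨁ i : ℤ, GrPiece F i

/-- The class in `gr_i X ⊆ gr X` of an element of `F_i X`. -/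
def grSymbol {X : Type*} [AddCommGroup X] [Module R X] (F : ℤ → Submodule R X) (i : ℤ) :
    F i →ₗ[R] Gr F :=
  DirectSum.lof R ℤ (GrPiece F) i ∘ₗ GrPiece.mk F i

section Structures

variable {B : Type*} [Ring B] [Algebra R B] (F : ℤ → Submodule R B)
  [IsRingFiltration F (fun i ↦ F (i - 1))]
  {N : Type*} [AddCommGroup N] [Module R N] [Module B N]
  (G : ℤ → Submodule R N) [IsModuleFiltration F (fun i ↦ F (i - 1)) G (fun i ↦ G (i - 1))]

instance : IsModuleFiltration F (fun i ↦ F (i - 1)) F (fun i ↦ F (i - 1)) where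
  __ := (inferInstance : IsFiltration F (fun i ↦ F (i - 1)))
  smul_mem := fun {_ _ _ _} ha hb ↦ SetLike.mul_mem_graded ha hb

theorem smul_mem_filtration {i j : ℤ} {b : B} {x : N} (hb : b ∈ F i) (hx : x ∈ G j) :
    b • x ∈ G (i + j) :=
  SetLike.GradedSMul.smul_mem (A := F) (B := G) hb hx

variable [IsScalarTower R B N]

/-- The action `gr_i B × gr_j N → gr_{i+j} N` induced by the action of `B` on `N`. -/
def grSMul (i j : ℤ) : GrPiece F i →ₗ[R] GrPiece G j →ₗ[R] GrPiece G (i + j) :=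
  have : SMulCommClass R B N := inferInstance
  let a : F i →ₗ[R] G j →ₗ[R] GrPiece G (i + j) :=
    LinearMap.mk₂ R
      (fun b x ↦ GrPiece.mk G (i + j) ⟨(b : B) • (x : N), smul_mem_filtration F G b.2 x.2⟩)
      (fun b b' x ↦ by rw [← map_add]; congr 1; ext; simp [add_smul])
      (fun r b x ↦ by rw [← map_smul]; congr 1; ext; simp)
      (fun b x x' ↦ by rw [← map_add]; congr 1; ext; simp)
      (fun r b x ↦ by rw [← map_smul]; congr 1; ext; exact smul_comm _ _ _)
  let a' : GrPiece F i →ₗ[R] G j →ₗ[R] GrPiece G (i + j) :=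
    Submodule.liftQ _ a (by
      intro b hb
      ext x
      refine (GrPiece.mk_eq_zero G (i + j) _).2 ?_
      have := smul_mem_filtration F G (show (b : B) ∈ F (i - 1) from hb) x.2
      rwa [show i - 1 + j = i + j - 1 by ring] at this)
  (Submodule.liftQ _ a'.flip (by
    intro x hx
    ext b
    obtain ⟨b, rfl⟩ := GrPiece.mk_surjective F i b
    refine (GrPiece.mk_eq_zero G (i + j) _).2 ?_
    have := smul_mem_filtration F G b.2 (show (x : N) ∈ G (j - 1) from hx)
    rwa [show i + (j - 1) = i + j - 1 by ring] at this)).flip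

theorem grSMul_mk (i j : ℤ) (b : F i) (x : G j) :
    grSMul F G i j (GrPiece.mk F i b) (GrPiece.mk G j x) =
      GrPiece.mk G (i + j) ⟨(b : B) • (x : N), smul_mem_filtration F G b.2 x.2⟩ := rfl

instance : GradedMonoid.GMul (GrPiece F) where
  mul x y := grSMul F F _ _ x y

instance : GradedMonoid.GOne (GrPiece F) where
  one := GrPiece.mk F 0 ⟨1, SetLike.GradedOne.one_mem⟩

instance : GradedMonoid.GMonoid (GrPiece F) where
  one_mul := by
    rintro ⟨i, x⟩
    obtain ⟨x, rfl⟩ := GrPiece.mk_surjective F i x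
    exact GrPiece.sigma_ext F (zero_add i) _ _ (one_mul _)
  mul_one := by
    rintro ⟨i, x⟩
    obtain ⟨x, rfl⟩ := GrPiece.mk_surjective F i x
    exact GrPiece.sigma_ext F (add_zero i) _ _ (mul_one _)
  mul_assoc := by
    rintro ⟨i, x⟩ ⟨j, y⟩ ⟨k, z⟩
    obtain ⟨x, rfl⟩ := GrPiece.mk_surjective F i x
    obtain ⟨y, rfl⟩ := GrPiece.mk_surjective F j y
    obtain ⟨z, rfl⟩ := GrPiece.mk_surjective F k z
    exact GrPiece.sigma_ext F (add_assoc i j k) _ _ (mul_assoc _ _ _)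

instance : DirectSum.GRing (GrPiece F) where
  mul_zero x := map_zero (grSMul F F _ _ x)
  zero_mul y := LinearMap.map_zero₂ (grSMul F F _ _) y
  mul_add x y z := map_add (grSMul F F _ _ x) y z
  add_mul x y z := LinearMap.map_add₂ (grSMul F F _ _) x y z
  natCast n := n • GrPiece.mk F 0 ⟨1, SetLike.GradedOne.one_mem⟩
  natCast_zero := zero_smul _ _
  natCast_succ n := by rw [add_smul, one_smul]; rfl
  intCast n := n • GrPiece.mk F 0 ⟨1, SetLike.GradedOne.one_mem⟩
  intCast_ofNat n := by simp
  intCast_negSucc_ofNat n := by rw [negSucc_zsmul]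

instance : DirectSum.Gmodule (GrPiece F) (GrPiece G) where
  smul x y := grSMul F G _ _ x y
  one_smul := by
    rintro ⟨i, x⟩
    obtain ⟨x, rfl⟩ := GrPiece.mk_surjective G i x
    exact GrPiece.sigma_ext G (zero_add i) _ _ (one_smul _ _)
  mul_smul := by
    rintro ⟨i, x⟩ ⟨j, y⟩ ⟨k, z⟩
    obtain ⟨x, rfl⟩ := GrPiece.mk_surjective F i x
    obtain ⟨y, rfl⟩ := GrPiece.mk_surjective F j y
    obtain ⟨z, rfl⟩ := GrPiece.mk_surjective G k z
    exact GrPiece.sigma_ext G (add_assoc i j k) _ _ (mul_smul _ _ _)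
  smul_add x y z := map_add (grSMul F G _ _ x) y z
  smul_zero x := map_zero (grSMul F G _ _ x)
  add_smul x y z := LinearMap.map_add₂ (grSMul F G _ _) x y z
  zero_smul y := LinearMap.map_zero₂ (grSMul F G _ _) y

end Structures
end GradedDefs

noncomputable section CompletionDefs

variable {R : Type*} [CommRing R] (π : R)

/-- The two-sided ideal `b B` of an `R`-algebra `B`, for `b ∈ R`. -/
def scalarIdeal (r : R) (B : Type*) [Ring B] [Algebra R B] : Ideal B :=
  Ideal.span {algebraMap R B r}

section ScalarIdeal

variable (r : R) (B : Type*) [Ring B] [Algebra R B]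

theorem mem_scalarIdeal {r : R} {B : Type*} [Ring B] [Algebra R B] {x : B} :
    x ∈ scalarIdeal r B ↔ ∃ y : B, x = r • y := by
  simp only [scalarIdeal, Ideal.mem_span_singleton', Algebra.smul_def]
  exact exists_congr fun y ↦ by rw [Algebra.commutes, eq_comm]

instance scalarIdeal.isTwoSided : (scalarIdeal r B).IsTwoSided where
  mul_mem_of_left {a} b h := by
    rw [mem_scalarIdeal] at h ⊢
    obtain ⟨y, rfl⟩ := h
    exact ⟨y * b, by simp⟩

theorem scalarIdeal_pow_le {i j : ℕ} (h : i ≤ j) :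
    scalarIdeal (π ^ j) B ≤ scalarIdeal (π ^ i) B := by
  intro x hx
  rw [mem_scalarIdeal] at hx ⊢
  obtain ⟨y, rfl⟩ := hx
  exact ⟨π ^ (j - i) • y, by rw [smul_smul, ← pow_add, Nat.add_sub_cancel' h]⟩

end ScalarIdeal

/-- The `π`-adic completion `lim B / π ^ j B` of a (not necessarily commutative) `R`-algebra. -/
def piCompletion (B : Type*) [Ring B] [Algebra R B] :
    Subalgebra R (∀ j : ℕ, B ⧸ scalarIdeal (π ^ j) B) where
  carrier := {x | ∀ (i j : ℕ) (h : i ≤ j),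
    Ideal.Quotient.factorₐ R (scalarIdeal_pow_le π B h) (x j) = x i}
  mul_mem' hx hy i j h := (map_mul _ _ _).trans (congrArg₂ (· * ·) (hx i j h) (hy i j h))
  add_mem' hx hy i j h := (map_add _ _ _).trans (congrArg₂ (· + ·) (hx i j h) (hy i j h))
  algebraMap_mem' r i j h := by simp

section Completion

variable (B : Type*) [Ring B] [Algebra R B]

/-- The canonical map from an `R`-algebra to its `π`-adic completion. -/
def toPiCompletion : B →ₐ[R] piCompletion π B :=
  (AlgHom.pi fun j ↦ Ideal.Quotient.mkₐ R (scalarIdeal (π ^ j) B)).codRestrict _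
    fun _ _ _ _ ↦ rfl

variable {π B}

theorem toPiCompletion_apply (b : B) (j : ℕ) :
    (toPiCompletion π B b : ∀ j, B ⧸ scalarIdeal (π ^ j) B) j = Ideal.Quotient.mk _ b := rfl

theorem piCompletion_torsionFree (hB : ∀ b : B, π • b = 0 → b = 0)
    (x : piCompletion π B) (hx : π • x = 0) : x = 0 := by
  ext j
  obtain ⟨u, hu⟩ := Ideal.Quotient.mk_surjective (x.1 (j + 1))
  have h1 : π • x.1 (j + 1) = 0 := congrFun (congrArg Subtype.val hx) (j + 1)
  have h2 := x.2 j (j + 1) (Nat.le_succ j)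
  rw [← hu] at h1 h2
  have h3 : Ideal.Quotient.mk (scalarIdeal (π ^ (j + 1)) B) (π • u) = 0 := h1
  rw [Ideal.Quotient.eq_zero_iff_mem, mem_scalarIdeal] at h3
  obtain ⟨v, hv⟩ := h3
  have h4 : u - π ^ j • v = 0 := hB _ (by rw [smul_sub, hv, smul_smul, pow_succ', sub_self])
  rw [← h2]
  change Ideal.Quotient.mk (scalarIdeal (π ^ j) B) u = 0
  rw [Ideal.Quotient.eq_zero_iff_mem, mem_scalarIdeal]
  exact ⟨v, sub_eq_zero.1 h4⟩

theorem piCompletion_separated (x : piCompletion π B)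
    (hx : ∀ i : ℕ, ∃ y : piCompletion π B, x = π ^ i • y) : x = 0 := by
  ext j
  obtain ⟨y, rfl⟩ := hx j
  obtain ⟨u, hu⟩ := Ideal.Quotient.mk_surjective (y.1 j)
  change π ^ j • y.1 j = 0
  rw [← hu]
  change Ideal.Quotient.mk (scalarIdeal (π ^ j) B) (π ^ j • u) = 0
  rw [Ideal.Quotient.eq_zero_iff_mem, mem_scalarIdeal]
  exact ⟨u, rfl⟩

theorem piCompletion_approx (hB : ∀ b : B, π • b = 0 → b = 0) (x : piCompletion π B) :
    ∃ (b : B) (y : piCompletion π B), x = toPiCompletion π B b + π • y := by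
  choose u hu using fun j ↦ Ideal.Quotient.mk_surjective (x.1 j)
  have hcomp : ∀ i j, i ≤ j → ∃ v, u j - u i = π ^ i • v := by
    intro i j h
    have := x.2 i j h
    rw [← hu, ← hu] at this
    replace this : Ideal.Quotient.mk (scalarIdeal (π ^ i) B) (u j) = Ideal.Quotient.mk _ (u i) :=
      this
    rwa [Ideal.Quotient.mk_eq_mk_iff_sub_mem, mem_scalarIdeal] at this
  choose w hw using fun j ↦ hcomp 1 (j + 1) (Nat.le_add_left 1 j)
  refine ⟨u 1, ⟨fun j ↦ Ideal.Quotient.mk _ (w j), ?_⟩, ?_⟩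
  · intro i j h
    change Ideal.Quotient.mk (scalarIdeal (π ^ i) B) (w j) = Ideal.Quotient.mk _ (w i)
    rw [Ideal.Quotient.mk_eq_mk_iff_sub_mem, mem_scalarIdeal]
    obtain ⟨v, hv⟩ := hcomp (i + 1) (j + 1) (Nat.succ_le_succ h)
    refine ⟨v, sub_eq_zero.1 (hB _ ?_)⟩
    rw [smul_sub, smul_sub, smul_smul, ← pow_succ', ← hv]
    have h1 := hw i
    have h2 := hw j
    rw [pow_one] at h1 h2
    rw [← h1, ← h2]
    abel
  · ext j
    change x.1 j = Ideal.Quotient.mk (scalarIdeal (π ^ j) B) (u 1 + π • w j)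
    have h2 := hw j
    rw [pow_one] at h2
    rw [← h2, add_sub_cancel, ← x.2 j (j + 1) (Nat.le_succ j), ← hu]
    rfl

end Completion

end CompletionDefs

noncomputable section DoubleFiltrations

variable {R : Type*} [CommRing R] (π : R) (K : Type*) [Field K] [Algebra R K]

/-- `L` is an `R`-lattice in the `K`-vector space `V`: `V = K L` and `⋂ π ^ i L = 0`. -/
def IsRLattice {V : Type*} [AddCommGroup V] [Module R V] [Module K V]
    (L : Submodule R V) : Prop :=
  Submodule.span K (L : Set V) = ⊤ ∧ ⨅ i : ℕ, π ^ i • L = ⊥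

/-- A doubly filtered `K`-algebra: an `R`-subalgebra `F₀ A` that is an `R`-lattice, and a filtration
on the slice `gr₀ A = F₀ A / π F₀ A`. -/
structure DoublyFilteredAlgebra (A : Type*) [Ring A] [Algebra R A] [Algebra K A] where
  F₀ : Subalgebra R A
  isRLattice : IsRLattice π K F₀.toSubmodule
  filt : ℤ → Submodule R (F₀ ⧸ scalarIdeal π F₀)
  isRingFiltration : IsRingFiltration filt (fun i ↦ filt (i - 1))
  exhaustive : ∀ x, ∃ i, x ∈ filt i

attribute [instance] DoublyFilteredAlgebra.isRingFiltration

variable {π K}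

/-- `s ∈ Gr(A)` is the class in degree `i` of the element `a ∈ F₀ A`, whose image in the slice
lies in the `i`-th step of the filtration. -/
def DoublyFilteredAlgebra.IsSymbol {A : Type*} [Ring A] [Algebra R A] [Algebra K A]
    (𝓐 : DoublyFilteredAlgebra π K A) (i : ℤ) (a : A) (s : Gr 𝓐.filt) : Prop :=
  ∃ (h : a ∈ 𝓐.F₀) (h' : Ideal.Quotient.mk (scalarIdeal π 𝓐.F₀) ⟨a, h⟩ ∈ 𝓐.filt i),
    s = grSymbol 𝓐.filt i ⟨_, h'⟩

section ModuleFiltration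

variable {A : Type*} [Ring A] [Algebra R A] [Algebra K A] (𝓐 : DoublyFilteredAlgebra π K A)

/-- The slice `L / π L` of an `F₀ A`-submodule `L` of an `A`-module. -/
def ModuleSlice {V : Type*} [AddCommGroup V] [Module A V] (L : Submodule 𝓐.F₀ V) : Type _ :=
  L ⧸ scalarIdeal π 𝓐.F₀ • (⊤ : Submodule 𝓐.F₀ L)

section ModuleSlice

variable {V : Type*} [AddCommGroup V] [Module A V] (L : Submodule 𝓐.F₀ V)

instance : AddCommGroup (ModuleSlice 𝓐 L) :=
  inferInstanceAs (AddCommGroup (L ⧸ scalarIdeal π 𝓐.F₀ • (⊤ : Submodule 𝓐.F₀ L)))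

instance : Module (𝓐.F₀ ⧸ scalarIdeal π 𝓐.F₀) (ModuleSlice 𝓐 L) :=
  inferInstanceAs (Module (𝓐.F₀ ⧸ scalarIdeal π 𝓐.F₀)
    (L ⧸ scalarIdeal π 𝓐.F₀ • (⊤ : Submodule 𝓐.F₀ L)))

instance [Module R V] [IsScalarTower R A V] : Module R (ModuleSlice 𝓐 L) :=
  inferInstanceAs (Module R (L ⧸ scalarIdeal π 𝓐.F₀ • (⊤ : Submodule 𝓐.F₀ L)))

/-- The class in the slice of an element of `L`. -/
def ModuleSlice.mk : L →+ ModuleSlice 𝓐 L :=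
  (Submodule.mkQ (scalarIdeal π 𝓐.F₀ • (⊤ : Submodule 𝓐.F₀ L))).toAddMonoidHom

instance [Module R V] [IsScalarTower R A V] :
    IsScalarTower R (𝓐.F₀ ⧸ scalarIdeal π 𝓐.F₀) (ModuleSlice 𝓐 L) where
  smul_assoc r a x := by
    obtain ⟨a, rfl⟩ := Ideal.Quotient.mk_surjective a
    obtain ⟨x, rfl⟩ := Submodule.Quotient.mk_surjective _ x
    exact congrArg (ModuleSlice.mk 𝓐 L) (smul_assoc r a x)

end ModuleSlice

variable (V : Type*) [AddCommGroup V] [Module R V] [Module K V] [Module A V]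
  [IsScalarTower R K V] [IsScalarTower K A V] [IsScalarTower R A V]

/-- A double filtration on an `A`-module `V`: an `F₀ A`-submodule `L` that is an `R`-lattice and a
filtration on the slice `gr₀ V = L / π L`, compatible with the filtration on the slice of `A`. -/
structure DoubleFiltration where
  L : Submodule 𝓐.F₀ V
  isRLattice : IsRLattice π K (L.restrictScalars R)
  filt : ℤ → Submodule R (ModuleSlice 𝓐 L)
  isModuleFiltration : IsModuleFiltration 𝓐.filt (fun i ↦ 𝓐.filt (i - 1))
    filt (fun i ↦ filt (i - 1))
  exhaustive : ∀ x, ∃ i, x ∈ filt i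

attribute [instance] DoubleFiltration.isModuleFiltration

variable {𝓐 V}

/-- A double filtration is good if the filtration on the slice is separated and `Gr(V)` is a
finitely generated `Gr(A)`-module. -/
def DoubleFiltration.IsGood (D : DoubleFiltration 𝓐 V) : Prop :=
  ⨅ i, D.filt i = ⊥ ∧ Module.Finite (Gr 𝓐.filt) (Gr D.filt)

/-- `s ∈ Gr(V)` is the class in degree `i` of the element `v ∈ L`, whose image in the slice
lies in the `i`-th step of the filtration. -/
def DoubleFiltration.IsSymbol (D : DoubleFiltration 𝓐 V) (i : ℤ) (v : V) (s : Gr D.filt) : Prop :=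
  ∃ (h : v ∈ D.L) (h' : ModuleSlice.mk 𝓐 D.L ⟨v, h⟩ ∈ D.filt i),
    s = grSymbol D.filt i ⟨_, h'⟩

end ModuleFiltration

section Completed

variable (π K)

/-- The `K`-algebra `B^ ⊗ K`, where `B^` is the `π`-adic completion of `B`. -/
def CompletedAlg (B : Type*) [Ring B] [Algebra R B] : Type _ := K ⊗[R] piCompletion π B

section Instances

variable (B : Type*) [Ring B] [Algebra R B]

instance : Ring (CompletedAlg π K B) := inferInstanceAs (Ring (K ⊗[R] piCompletion π B))
instance : Algebra R (CompletedAlg π K B) :=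
  inferInstanceAs (Algebra R (K ⊗[R] piCompletion π B))
instance : Algebra K (CompletedAlg π K B) :=
  inferInstanceAs (Algebra K (K ⊗[R] piCompletion π B))
instance : IsScalarTower R K (CompletedAlg π K B) :=
  inferInstanceAs (IsScalarTower R K (K ⊗[R] piCompletion π B))

/-- The canonical map `B^ → B^ ⊗ K`. -/
def completionToCompletedAlg : piCompletion π B →ₐ[R] CompletedAlg π K B :=
  (Algebra.TensorProduct.includeRight : piCompletion π B →ₐ[R] K ⊗[R] piCompletion π B)

/-- The subring `B^` of `B^ ⊗ K`. -/
def completedF₀ : Subalgebra R (CompletedAlg π K B) := (completionToCompletedAlg π K B).range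

/-- The canonical map from `B` to the slice of `B^ ⊗ K`. -/
def toCompletedSlice : B →ₐ[R] completedF₀ π K B ⧸ scalarIdeal π (completedF₀ π K B) :=
  ((Ideal.Quotient.mkₐ R (scalarIdeal π (completedF₀ π K B))).comp
    (completionToCompletedAlg π K B).rangeRestrict).comp (toPiCompletion π B)

end Instances

variable {B : Type*} [Ring B] [Algebra R B]

theorem isTorsionFree_of_uniformizer [IsDomain R] [IsDiscreteValuationRing R] (hπ : Irreducible π)
    (X : Type*) [AddCommGroup X] [Module R X] (hX : ∀ x : X, π • x = 0 → x = 0) :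
    Module.IsTorsionFree R X := by
  rw [Module.isTorsionFree_iff_smul_eq_zero]
  intro r x h
  by_contra! hne
  obtain ⟨n, u, rfl⟩ := IsDiscreteValuationRing.eq_unit_mul_pow_irreducible hne.1 hπ
  rw [mul_smul, ← Units.smul_def, smul_eq_zero_iff_eq] at h
  refine hne.2 ?_
  clear hne
  induction n with
  | zero => rwa [pow_zero, one_smul] at h
  | succ n ih =>
    rw [pow_succ', mul_smul] at h
    exact ih (hX _ h)

theorem completionToCompletedAlg_injective [IsDomain R] [IsDiscreteValuationRing R]
    [IsFractionRing R K] (hπ : Irreducible π) (hB : ∀ b : B, π • b = 0 → b = 0) :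
    Function.Injective (completionToCompletedAlg π K B) := by
  have htf : Module.IsTorsionFree R (piCompletion π B) :=
    isTorsionFree_of_uniformizer π hπ _ (piCompletion_torsionFree hB)
  have : Module.Flat R (piCompletion π B) := inferInstance
  exact Algebra.TensorProduct.includeRight_injective (IsFractionRing.injective R K)

theorem span_completedF₀ :
    Submodule.span K ((completedF₀ π K B).toSubmodule : Set (CompletedAlg π K B)) = ⊤ := by
  rw [eq_top_iff]
  rintro x -
  change K ⊗[R] piCompletion π B at x
  induction x with
  | zero => exact zero_mem (Submodule.span K _)
  | add x y hx hy => exact add_mem (S := Submodule K (CompletedAlg π K B)) hx hy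
  | tmul a b =>
    have : (a ⊗ₜ[R] b : K ⊗[R] piCompletion π B) = a • (1 : K) ⊗ₜ[R] b := by
      rw [TensorProduct.smul_tmul', smul_eq_mul, mul_one]
    rw [this]
    exact Submodule.smul_mem (M := CompletedAlg π K B) _ _ (Submodule.subset_span ⟨b, rfl⟩)

theorem completedF₀_isRLattice [IsDomain R] [IsDiscreteValuationRing R] [IsFractionRing R K]
    (hπ : Irreducible π) (hB : ∀ b : B, π • b = 0 → b = 0) :
    IsRLattice π K (completedF₀ π K B).toSubmodule := by
  refine ⟨span_completedF₀ π K, ?_⟩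
  rw [eq_bot_iff]
  intro x hx
  rw [Submodule.mem_iInf] at hx
  have hinj := completionToCompletedAlg_injective π K hπ hB
  choose y hy hyx using fun i ↦ Submodule.mem_smul_pointwise_iff_exists _ _ _ |>.1 (hx i)
  choose z hz using hy
  have h0 : x = completionToCompletedAlg π K B (z 0) := by
    rw [← hyx 0, pow_zero, one_smul]; exact (hz 0).symm
  have : z 0 = 0 := by
    refine piCompletion_separated _ fun i ↦ ⟨z i, hinj ?_⟩
    rw [← h0, map_smul, ← hyx i]
    congr 1
    exact (hz i).symm
  rw [h0, this, map_zero]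
  exact zero_mem _

theorem toCompletedSlice_surjective (hB : ∀ b : B, π • b = 0 → b = 0) :
    Function.Surjective (toCompletedSlice π K B) := by
  intro s
  obtain ⟨⟨_, x, rfl⟩, rfl⟩ := Ideal.Quotient.mk_surjective s
  obtain ⟨b, y, rfl⟩ := piCompletion_approx hB x
  refine ⟨b, (Ideal.Quotient.mk_eq_mk_iff_sub_mem _ _).2 ?_⟩
  rw [mem_scalarIdeal]
  refine ⟨-⟨_, y, rfl⟩, Subtype.ext ?_⟩
  change completionToCompletedAlg π K B (toPiCompletion π B b) -
    completionToCompletedAlg π K B (toPiCompletion π B b + π • y) =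
    π • -completionToCompletedAlg π K B y
  rw [map_add, map_smul, smul_neg]
  abel

/-- For a filtered `π`-torsionfree `R`-algebra `B`, the `K`-algebra `B^ ⊗ K` is doubly filtered: the
lattice is `B^`, and the slice `B^ / π B^ = B / π B` carries the quotient filtration. -/
def completedDoublyFiltered [IsDomain R] [IsDiscreteValuationRing R] [IsFractionRing R K]
    (hπ : Irreducible π) (hB : ∀ b : B, π • b = 0 → b = 0)
    (F : ℤ → Submodule R B) [IsRingFiltration F (fun i ↦ F (i - 1))]
    (hF : ∀ b, ∃ i, b ∈ F i) :
    DoublyFilteredAlgebra π K (CompletedAlg π K B) where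
  F₀ := completedF₀ π K B
  isRLattice := completedF₀_isRLattice π K hπ hB
  filt i := (F i).map (toCompletedSlice π K B).toLinearMap
  isRingFiltration :=
    have : SetLike.GradedMonoid fun i ↦ (F i).map (toCompletedSlice π K B).toLinearMap :=
      { one_mem := ⟨1, SetLike.GradedOne.one_mem, map_one (toCompletedSlice π K B)⟩
        mul_mem := by
          rintro i j _ _ ⟨a, ha, rfl⟩ ⟨b, hb, rfl⟩
          exact ⟨a * b, SetLike.mul_mem_graded ha hb, map_mul (toCompletedSlice π K B) a b⟩ }
    IsRingFiltration.mk_int _ fun i j h ↦ Submodule.map_mono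
      (IsFiltration.mono (F_lt := fun i ↦ F (i - 1)) h)
  exhaustive x := by
    obtain ⟨b, rfl⟩ := toCompletedSlice_surjective π K hB x
    obtain ⟨i, hi⟩ := hF b
    exact ⟨i, b, hi, rfl⟩

end Completed

end DoubleFiltrations

noncomputable section Deformations

variable {R : Type*} [CommRing R]

section Modules

variable (π : R) {X : Type*} [AddCommGroup X] [Module R X] (F : ℤ → Submodule R X) (n : ℕ)

/-- The `n`-th deformation `∑_{j ≥ 0} π ^ (j n) F_j X`. -/
def deformation : Submodule R X := ⨆ j : ℕ, π ^ (j * n) • F j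

/-- The filtration `F_i X_n = ∑_{0 ≤ j ≤ i} π ^ (j n) F_j X` of the `n`-th deformation `X_n`. -/
def deformationFilt (i : ℤ) : Submodule R X := ⨆ (j : ℕ) (_ : (j : ℤ) ≤ i), π ^ (j * n) • F j

theorem deformationFilt_mono : Monotone (deformationFilt π F n) := fun _ _ h ↦
  iSup₂_le fun j hj ↦ le_iSup₂_of_le j (hj.trans h) le_rfl

theorem le_deformationFilt (j : ℕ) : π ^ (j * n) • F j ≤ deformationFilt π F n j :=
  le_iSup₂_of_le (f := fun (k : ℕ) (_ : (k : ℤ) ≤ j) ↦ π ^ (k * n) • F k) j le_rfl le_rfl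

theorem deformationFilt_le (i : ℤ) : deformationFilt π F n i ≤ deformation π F n :=
  iSup₂_le fun j _ ↦ le_iSup (fun j : ℕ ↦ π ^ (j * n) • F j) j

theorem exists_mem_deformationFilt {x : X} (hx : x ∈ deformation π F n) :
    ∃ i, x ∈ deformationFilt π F n i := by
  induction hx using Submodule.iSup_induction' with
  | mem j x hx => exact ⟨j, le_deformationFilt π F n j hx⟩
  | zero => exact ⟨0, zero_mem _⟩
  | add x y _ _ hx hy =>
    obtain ⟨i, hi⟩ := hx
    obtain ⟨j, hj⟩ := hy
    exact ⟨max i j, add_mem (deformationFilt_mono π F n (le_max_left i j) hi)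
      (deformationFilt_mono π F n (le_max_right i j) hj)⟩

end Modules

section Algebras

variable (π : R) {U : Type*} [Ring U] [Algebra R U] (F : ℤ → Submodule R U)
  [IsRingFiltration F (fun i ↦ F (i - 1))] (n : ℕ)

theorem deformationFilt_mul (i j : ℤ) :
    deformationFilt π F n i * deformationFilt π F n j ≤ deformationFilt π F n (i + j) := by
  conv_lhs => rw [deformationFilt, deformationFilt]
  simp only [Submodule.iSup_mul, Submodule.mul_iSup, iSup_le_iff]
  intro k hk l hl
  rw [Submodule.mul_le]
  rintro _ ⟨a, ha, rfl⟩ _ ⟨b, hb, rfl⟩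
  refine deformationFilt_mono π F n (show ((l + k : ℕ) : ℤ) ≤ i + j by push_cast; omega)
    (le_deformationFilt π F n _ ⟨a * b, ?_, ?_⟩)
  · push_cast
    exact SetLike.mul_mem_graded ha hb
  · simp [smul_smul, ← pow_add, add_mul, add_comm]

theorem one_mem_deformationFilt : (1 : U) ∈ deformationFilt π F n 0 :=
  le_deformationFilt π F n 0 ⟨1, show (1 : U) ∈ F 0 from SetLike.GradedOne.one_mem, by simp⟩

/-- The `n`-th deformation `U_n` of a filtered `R`-algebra `U`, as a subalgebra of `U`. -/
def deformedAlg : Subalgebra R U :=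
  (deformation π F n).toSubalgebra
    (deformationFilt_le π F n 0 (one_mem_deformationFilt π F n))
    (by
      intro x y hx hy
      obtain ⟨i, hi⟩ := exists_mem_deformationFilt π F n hx
      obtain ⟨j, hj⟩ := exists_mem_deformationFilt π F n hy
      exact deformationFilt_le π F n _ (deformationFilt_mul π F n i j (Submodule.mul_mem_mul hi hj)))

/-- The filtration of `U_n` by the submodules `F_i U_n`. -/
def deformedAlgFilt (i : ℤ) : Submodule R (deformedAlg π F n) :=
  (deformationFilt π F n i).comap (deformedAlg π F n).val.toLinearMap

instance deformedAlgFilt_isRingFiltration :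
    IsRingFiltration (deformedAlgFilt π F n) (fun i ↦ deformedAlgFilt π F n (i - 1)) :=
  have : SetLike.GradedMonoid (deformedAlgFilt π F n) :=
    { one_mem := one_mem_deformationFilt π F n
      mul_mem := fun {i j _ _} ha hb ↦
        deformationFilt_mul π F n i j (Submodule.mul_mem_mul ha hb) }
  IsRingFiltration.mk_int _ fun _ _ h ↦ Submodule.comap_mono (deformationFilt_mono π F n h)

theorem deformedAlgFilt_exhaustive (x : deformedAlg π F n) : ∃ i, x ∈ deformedAlgFilt π F n i :=
  exists_mem_deformationFilt π F n x.2

/-- A deformable `R`-algebra: a positively filtered `R`-algebra whose associated graded is flat. -/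
structure IsDeformable (F : ℤ → Submodule R U) [IsRingFiltration F (fun i ↦ F (i - 1))] :
    Prop where
  eq_bot_of_neg : ∀ i < 0, F i = ⊥
  exhaustive : ∀ u, ∃ i, u ∈ F i
  flat : Module.Flat R (Gr F)

variable {π F}

theorem IsDeformable.torsionFree [IsDomain R] (hF : IsDeformable F) (hπ : Irreducible π) (u : U)
    (hu : π • u = 0) : u = 0 := by
  have := hF.flat
  have htf : Module.IsTorsionFree R (Gr F) := inferInstance
  have key : ∀ i, u ∈ F i → u ∈ F (i - 1) := by
    intro i hi
    have h0 : π • GrPiece.mk F i ⟨u, hi⟩ = 0 := by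
      rw [← map_smul, GrPiece.mk_eq_zero]
      change π • u ∈ _
      rw [hu]
      exact zero_mem _
    have h1 : π • grSymbol F i ⟨u, hi⟩ = 0 := by
      rw [grSymbol, LinearMap.comp_apply, ← map_smul, h0, map_zero]
    rw [smul_eq_zero_iff_right hπ.ne_zero] at h1
    have h2 : GrPiece.mk F i ⟨u, hi⟩ = 0 :=
      DirectSum.of_injective (β := GrPiece F) i (h1.trans (map_zero _).symm)
    exact (GrPiece.mk_eq_zero F i _).1 h2
  obtain ⟨i, hi⟩ := hF.exhaustive u
  have h3 : ∀ m : ℕ, u ∈ F (i - m) := by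
    intro m
    induction m with
    | zero => simpa using hi
    | succ m ih => simpa [sub_sub] using key _ ih
  have h4 := h3 (i.toNat + 1)
  rwa [hF.eq_bot_of_neg _ (by omega), Submodule.mem_bot] at h4

theorem IsDeformable.deformedAlg_torsionFree [IsDomain R] (hF : IsDeformable F)
    (hπ : Irreducible π) (u : deformedAlg π F n) (hu : π • u = 0) : u = 0 :=
  Subtype.ext (hF.torsionFree hπ _ (congrArg Subtype.val hu))

variable [IsDomain R] (K : Type*) [Field K] [Algebra R K] [IsFractionRing R K]

theorem deformedAlg_tensor_bijective (hF : IsDeformable F) (hπ : Irreducible π) (n : ℕ) :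
    Function.Bijective (Algebra.TensorProduct.map (AlgHom.id K K) (deformedAlg π F n).val) := by
  constructor
  · have : Module.Flat R K := IsLocalization.flat K (nonZeroDivisors R)
    exact Module.Flat.lTensor_preserves_injective_linearMap (M := K)
      (deformedAlg π F n).val.toLinearMap Subtype.val_injective
  · intro x
    induction x with
    | zero => exact ⟨0, map_zero _⟩
    | add x y hx hy =>
      obtain ⟨a, rfl⟩ := hx
      obtain ⟨b, rfl⟩ := hy
      exact ⟨a + b, map_add _ _ _⟩
    | tmul c u =>
      obtain ⟨i, hi⟩ := hF.exhaustive u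
      have hi' : u ∈ F i.toNat :=
        (IsFiltration.mono (F := F) (F_lt := fun i ↦ F (i - 1)) (Int.self_le_toNat i) :
          F i ≤ F i.toNat) hi
      have hmem : π ^ (i.toNat * n) • u ∈ deformedAlg π F n :=
        deformationFilt_le π F n _ (le_deformationFilt π F n i.toNat ⟨u, hi', rfl⟩)
      have h0 : algebraMap R K (π ^ (i.toNat * n)) ≠ 0 :=
        (map_ne_zero_iff _ (IsFractionRing.injective R K)).2 (pow_ne_zero _ hπ.ne_zero)
      refine ⟨(c * (algebraMap R K (π ^ (i.toNat * n)))⁻¹) ⊗ₜ ⟨_, hmem⟩, ?_⟩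
      rw [Algebra.TensorProduct.map_tmul]
      change (c * _) ⊗ₜ[R] (π ^ (i.toNat * n) • u) = _
      rw [← TensorProduct.smul_tmul, Algebra.smul_def, mul_left_comm, mul_inv_cancel₀ h0, mul_one]

/-- The canonical map `U → U ⊗ K = U_n ⊗ K → (U_n)^ ⊗ K`. -/
def toCompletedDeformation (hF : IsDeformable F) (hπ : Irreducible π) (n : ℕ) :
    U →ₐ[R] CompletedAlg π K (deformedAlg π F n) :=
  let e := AlgEquiv.ofBijective _ (deformedAlg_tensor_bijective K hF hπ n)
  let c : K ⊗[R] deformedAlg π F n →ₐ[R] CompletedAlg π K (deformedAlg π F n) :=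
    (Algebra.TensorProduct.map (AlgHom.id R K) (toPiCompletion π (deformedAlg π F n)) :
      K ⊗[R] deformedAlg π F n →ₐ[R] K ⊗[R] piCompletion π (deformedAlg π F n))
  (c.comp (e.symm.toAlgHom.restrictScalars R)).comp
    (Algebra.TensorProduct.includeRight : U →ₐ[R] K ⊗[R] U)

variable [IsDiscreteValuationRing R]

/-- The doubly filtered `K`-algebra `(U_n)^ ⊗ K` attached to the `n`-th deformation of `U`. -/
def deformedDoublyFiltered (hF : IsDeformable F) (hπ : Irreducible π) (n : ℕ) :
    DoublyFilteredAlgebra π K (CompletedAlg π K (deformedAlg π F n)) :=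
  completedDoublyFiltered π K hπ (hF.deformedAlg_torsionFree n hπ) (deformedAlgFilt π F n)
    (deformedAlgFilt_exhaustive π F n)

end Algebras

section ModuleStructures

variable {U : Type*} [Ring U] [Algebra R U]

/-- A good filtration of a `U`-module `M`: an exhaustive filtration, vanishing in negative degrees,
of the form `F_i M = ∑_j F_{i - k_j} U m_j` for finitely many `m_j ∈ M` and `k_j ∈ ℤ`. -/
structure IsGoodFiltration (F : ℤ → Submodule R U) [IsRingFiltration F (fun i ↦ F (i - 1))]
    {M : Type*} [AddCommGroup M] [Module R M] [Module U M] [IsScalarTower R U M]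
    (G : ℤ → Submodule R M) : Prop where
  isModuleFiltration : IsModuleFiltration F (fun i ↦ F (i - 1)) G (fun i ↦ G (i - 1))
  eq_bot_of_neg : ∀ i < 0, G i = ⊥
  exhaustive : ∀ m, ∃ i, m ∈ G i
  exists_generators : ∃ (r : ℕ) (k : Fin r → ℤ) (m : Fin r → M), ∀ i,
    G i = ⨆ j, (F (i - k j)).map ((LinearMap.toSpanSingleton U M (m j)).restrictScalars R)

variable {A : Type*} [Ring A] [Algebra R A] (f : U →ₐ[R] A)
  (M : Type*) [AddCommGroup M] [Module R M] [Module U M]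

/-- The left `A`-module `A ⊗_U M`, for a homomorphism `f : U → A` of (not necessarily commutative)
`R`-algebras and a left `U`-module `M`. -/
def BaseChange : Type _ :=
  (A ⊗[R] M) ⧸ Submodule.span A
    {x | ∃ (a : A) (u : U) (m : M), x = (a * f u) ⊗ₜ[R] m - a ⊗ₜ[R] (u • m)}

instance : AddCommGroup (BaseChange f M) := inferInstanceAs (AddCommGroup (_ ⧸ Submodule.span A _))
instance : Module A (BaseChange f M) := inferInstanceAs (Module A (_ ⧸ Submodule.span A _))
instance : Module R (BaseChange f M) := inferInstanceAs (Module R (_ ⧸ Submodule.span A _))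
instance : IsScalarTower R A (BaseChange f M) :=
  inferInstanceAs (IsScalarTower R A (_ ⧸ Submodule.span A _))

section FieldStructure

variable {K : Type*} [Field K] [Algebra R K] [Algebra K A] [IsScalarTower R K A]

instance : Module K (BaseChange f M) := inferInstanceAs (Module K (_ ⧸ Submodule.span A _))
instance : IsScalarTower K A (BaseChange f M) :=
  inferInstanceAs (IsScalarTower K A (_ ⧸ Submodule.span A _))
instance : IsScalarTower R K (BaseChange f M) :=
  inferInstanceAs (IsScalarTower R K (_ ⧸ Submodule.span A _))

end FieldStructure

/-- The map `M → A ⊗_U M, m ↦ 1 ⊗ m`. -/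
def toBaseChange : M →ₗ[R] BaseChange f M :=
  (Submodule.mkQ (Submodule.span A
    {x | ∃ (a : A) (u : U) (m : M), x = (a * f u) ⊗ₜ[R] m - a ⊗ₜ[R] (u • m)})).restrictScalars R ∘ₗ
    TensorProduct.mk R A M 1

end ModuleStructures

section Induced

variable {π : R} {U : Type*} [Ring U] [Algebra R U] {F : ℤ → Submodule R U}
  [IsRingFiltration F (fun i ↦ F (i - 1))]
  {M : Type*} [AddCommGroup M] [Module R M] [Module U M] [IsScalarTower R U M]
  [IsDomain R] [IsDiscreteValuationRing R] {K : Type*} [Field K] [Algebra R K]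
  [IsFractionRing R K] {hF : IsDeformable F} {hπ : Irreducible π} {n : ℕ}

/-- The double filtration on `(U_n)^ ⊗ K ⊗_U M` is the one induced by the deformation `M_n` for the
filtration `G` of `M`: its lattice is generated by the elements `1 ⊗ m` with `m ∈ M_n`, and the
`i`-th step of the filtration on the slice consists of the classes of `1 ⊗ m` with `m ∈ F_i M_n`. -/
def DoubleFiltration.IsInduced
    (D : DoubleFiltration (deformedDoublyFiltered K hF hπ n)
      (BaseChange (toCompletedDeformation K hF hπ n) M)) (G : ℤ → Submodule R M) : Prop :=
  D.L = Submodule.span _ (toBaseChange (toCompletedDeformation K hF hπ n) M '' deformation π G n) ∧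
  ∀ i x, x ∈ D.filt i ↔ ∃ m ∈ deformationFilt π G n i,
    ∃ h : toBaseChange (toCompletedDeformation K hF hπ n) M m ∈ D.L,
      ModuleSlice.mk _ D.L ⟨_, h⟩ = x

end Induced

end Deformations

/-! ### Deformations of a filtered module and the torsion of their graded pieces. -/

section DeformationLemmas

variable {R : Type*} [CommRing R] {π : R} {X : Type*} [AddCommGroup X] [Module R X]
  {G : ℤ → Submodule R X} {n : ℕ}

/-! The heart of the matter is a comparison of every slice with the fixed graded module `gr M`.
Multiplication by `π ^ (i n)` in degree `i` induces a surjection `gr M → gr (M_n / π M_n)`, because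
modulo `F_{i-1} M_n` only the summand `π ^ (i n) F_i M` survives (`IsDeformationImage.grMap`). Its
kernel always contains `π gr M` and, for large `n`, the `π`-power torsion of `gr M`. Since `gr M` is
finitely generated over the noetherian ring `gr U`, a single power `π ^ n₀` kills that torsion
(`IsGoodFiltration.exists_torsion_bound`). For `n ≥ n₀` the module `gr M_n` is then `π`-torsionfree
(`mem_deformationFilt_of_smul_mem`), and the kernel is exactly torsion plus `π gr M`
(`IsDeformationImage.grPieceMap_mk_eq_zero_iff`). This description does not involve `n`, so the
targets for `n₀` and `n` are quotients of `gr M` by the same submodule, hence isomorphic. The same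
argument applies to `U`, where flatness makes the torsion zero. Exponents `i n` are additive in `i`,
so the surjections respect products and actions, and so do the isomorphisms `ξ` and `μ`.

It remains to identify the slice of the lattice `L` generated by `M_n` with `M_n / π M_n`, and to
show that `L` is separated. Both are questions about relations among finitely many generators `π ^
e_j m_j` of `M_n`. Right exactness and clearing denominators show that a power of `π` times any
relation over the completion lies in the completed span of the relations over `U_n`. The relations
over `U_n` are finitely generated because `U_n` is noetherian
(`IsDeformable.isNoetherianRing_deformedAlg`), and saturated with respect to `π` because `M` is
torsionfree. Their completed span is therefore saturated too and `π`-adically closed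
(`mem_completedSpan_of_smul_mem`, `mem_completedSpan_of_forall`). Saturation yields all relations
over the completion (`mem_completedSpan_of_sum_eq_zero`), hence the slice; closedness yields
separatedness. Neither an Artin–Rees argument nor flatness of the completion over `U_n` is needed.
-/

theorem deformationFilt_of_neg {i : ℤ} (hi : i < 0) : deformationFilt π G n i = ⊥ := by
  rw [eq_bot_iff]
  exact iSup₂_le fun j hj ↦ by omega

theorem pow_smul_mem_deformationFilt {i : ℕ} {x : X} (hx : x ∈ G i) :
    π ^ (i * n) • x ∈ deformationFilt π G n i :=
  le_deformationFilt π G n i ⟨x, hx, rfl⟩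

theorem deformationFilt_le_filtration (hmono : Monotone G) (i : ℤ) :
    deformationFilt π G n i ≤ G i := by
  refine iSup₂_le fun j hj ↦ ?_
  rintro _ ⟨x, hx, rfl⟩
  exact (G i).smul_mem _ (hmono hj hx)

/-- Among the summands defining `F_i X_n`, only the one with `j = i` is not already in `F_{i-1}
X_n`. The decomposition is not unique; every argument on leading terms starts from it. -/
theorem exists_of_mem_deformationFilt {i : ℕ} {x : X} (hx : x ∈ deformationFilt π G n i) :
    ∃ v ∈ deformationFilt π G n (i - 1), ∃ w ∈ G i, x = v + π ^ (i * n) • w := by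
  have h : deformationFilt π G n i ≤ deformationFilt π G n (i - 1) ⊔ π ^ (i * n) • G i := by
    refine iSup₂_le fun j hj ↦ ?_
    rcases hj.lt_or_eq with h | h
    · exact (le_deformationFilt π G n j).trans
        ((deformationFilt_mono π G n (by omega)).trans le_sup_left)
    · obtain rfl : j = i := by omega
      exact le_sup_right
  obtain ⟨v, hv, _, ⟨w, hw, rfl⟩, rfl⟩ := Submodule.mem_sup.1 (h hx)
  exact ⟨v, hv, w, hw, rfl⟩

/-- On the summand of index `l ≤ j ≤ i` the exponents satisfy `i (n - n₀) + l n₀ = (i - l)(n - n₀) +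
l n`. Allowing `j < i` lets the factor attached to degree `i` also act on lower-order terms. -/
theorem pow_smul_mem_deformationFilt_of_le {n₀ : ℕ} (h : n₀ ≤ n) {i : ℕ} {j : ℤ} (hj : j ≤ i)
    {x : X} (hx : x ∈ deformationFilt π G n₀ j) :
    π ^ (i * (n - n₀)) • x ∈ deformationFilt π G n j := by
  suffices deformationFilt π G n₀ j ≤ (deformationFilt π G n j).comap
      (LinearMap.lsmul R X (π ^ (i * (n - n₀)))) from this hx
  refine iSup₂_le fun l hl ↦ ?_
  rintro _ ⟨x, hx, rfl⟩
  have h1 : i * (n - n₀) + l * n₀ = (i - l) * (n - n₀) + l * n := by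
    obtain ⟨a, rfl⟩ := Nat.exists_eq_add_of_le h
    obtain ⟨b, rfl⟩ := Nat.exists_eq_add_of_le (show l ≤ i by omega)
    simp only [Nat.add_sub_cancel_left]
    ring
  change π ^ (i * (n - n₀)) • π ^ (l * n₀) • x ∈ deformationFilt π G n j
  rw [smul_smul, ← pow_add, h1, pow_add, mul_smul]
  exact Submodule.smul_mem _ _ (deformationFilt_mono π G n hl (pow_smul_mem_deformationFilt hx))

theorem exists_pow_smul_mem_deformation (hmono : Monotone G) (hex : ∀ x : X, ∃ i, x ∈ G i) (x : X) :
    ∃ k : ℕ, ∀ l ≥ k, π ^ l • x ∈ deformation π G n := by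
  obtain ⟨i, hi⟩ := hex x
  refine ⟨i.toNat * n, fun l hl ↦ ?_⟩
  obtain ⟨c, rfl⟩ := Nat.exists_eq_add_of_le hl
  rw [add_comm, pow_add, mul_smul]
  exact Submodule.smul_mem _ _ (deformationFilt_le π G n _
    (pow_smul_mem_deformationFilt (hmono (Int.self_le_toNat i) hi)))

/-- If `π ^ n` kills the `π`-torsion of `gr X`, then `gr X_n` is `π`-torsionfree. -/
theorem mem_deformationFilt_of_smul_mem (hmono : Monotone G)
    (htors : ∀ i x, x ∈ G i → (∃ N : ℕ, π ^ N • x ∈ G (i - 1)) → π ^ n • x ∈ G (i - 1))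
    {i : ℕ} {x : X} (hx : x ∈ deformation π G n) (h : π • x ∈ deformationFilt π G n i) :
    x ∈ deformationFilt π G n i := by
  obtain ⟨k, hk⟩ := exists_mem_deformationFilt π G n hx
  obtain ⟨d, hd⟩ : ∃ d : ℕ, x ∈ deformationFilt π G n (i + d : ℕ) :=
    ⟨k.toNat, deformationFilt_mono π G n (by push_cast; have := Int.self_le_toNat k; omega) hk⟩
  clear hk
  induction d with
  | zero => simpa using hd
  | succ d ih =>
    -- Lower the degree by one. As `π x` has degree at most `i`, the leading coefficient `w`
    -- becomes, after a power of `π`, an element one step down, so it is torsion in `gr X`. Then `π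
    -- ^ n w` is one step down, and a factor `π ^ n` of the coefficient `π ^ ((i + d + 1) n)` can be
    -- spent on it.
    refine ih ?_
    obtain ⟨v, hv, w, hw, rfl⟩ := exists_of_mem_deformationFilt hd
    have e : ((i + (d + 1) : ℕ) : ℤ) - 1 = (i + d : ℕ) := by push_cast; ring
    rw [e] at hv
    refine add_mem hv ?_
    have h1 : π ^ ((i + (d + 1)) * n + 1) • w ∈ G ((i + (d + 1) : ℕ) - 1) := by
      rw [e]
      refine deformationFilt_le_filtration (π := π) (n := n) hmono _ ?_
      have h2 := sub_mem (deformationFilt_mono π G n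
        (show (i : ℤ) ≤ (i + d : ℕ) by push_cast; omega) h) (Submodule.smul_mem _ π hv)
      rwa [smul_add, add_sub_cancel_left, smul_smul, ← pow_succ'] at h2
    have h3 := htors _ w hw ⟨_, h1⟩
    rw [e] at h3
    have h4 := pow_smul_mem_deformationFilt (π := π) (n := n) h3
    rwa [smul_smul, ← pow_add, show (i + d) * n + n = (i + (d + 1)) * n by ring] at h4

end DeformationLemmas

/-! ### Comparison of `gr X` with the graded module of the slice of `X_n`. -/

noncomputable section Slices

variable {R : Type*} [CommRing R] {π : R} {X : Type*} [AddCommGroup X] [Module R X]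
  {G : ℤ → Submodule R X} {n : ℕ} {S : Type*} [AddCommGroup S] [Module R S]

/-- `E` is the image, under a linear map `σ` from the deformation `X_n`, of the filtration of
`X_n` attached to a positive filtration `G` of `X`. -/
structure IsDeformationImage (π : R) (G : ℤ → Submodule R X) (n : ℕ)
    (σ : deformation π G n →ₗ[R] S) (E : ℤ → Submodule R S) : Prop where
  mono : Monotone G
  eq_bot_of_neg : ∀ i < 0, G i = ⊥
  mem_iff : ∀ i s, s ∈ E i ↔
    ∃ (x : X) (h : x ∈ deformationFilt π G n i), σ ⟨x, deformationFilt_le π G n i h⟩ = s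

namespace IsDeformationImage

variable {σ : deformation π G n →ₗ[R] S} {E : ℤ → Submodule R S}
  (hE : IsDeformationImage π G n σ E)
include hE

theorem pow_smul_mem {i : ℤ} {x : X} (hx : x ∈ G i) :
    π ^ (i.toNat * n) • x ∈ deformationFilt π G n i := by
  rcases lt_or_ge i 0 with h | h
  · rw [hE.eq_bot_of_neg i h, Submodule.mem_bot] at hx
    rw [hx, smul_zero]
    exact zero_mem _
  · lift i to ℕ using h
    exact pow_smul_mem_deformationFilt hx

theorem map_mem {i : ℤ} {x : X} (hx : x ∈ deformationFilt π G n i) :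
    σ ⟨x, deformationFilt_le π G n i hx⟩ ∈ E i :=
  (hE.mem_iff i _).2 ⟨x, hx, rfl⟩

/-- The map `G_i → gr_i S`, `x ↦ [σ (π ^ (i n) x)]`. -/
def preSymbol (i : ℤ) : G i →ₗ[R] GrPiece E i where
  toFun x := GrPiece.mk E i ⟨_, hE.map_mem (hE.pow_smul_mem x.2)⟩
  map_add' x y := by
    rw [← map_add]
    congr 1
    ext
    change σ _ = σ _ + σ _
    rw [← map_add]
    congr 1
    ext
    exact smul_add _ _ _
  map_smul' r x := by
    rw [RingHom.id_apply, ← map_smul]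
    congr 1
    ext
    change σ _ = r • σ _
    rw [← map_smul]
    congr 1
    ext
    exact smul_comm _ _ _

/-- The map `gr_i X → gr_i S`, `[x] ↦ [σ (π ^ (i n) x)]`. -/
def grPieceMap (i : ℤ) : GrPiece G i →ₗ[R] GrPiece E i :=
  Submodule.liftQ _ (hE.preSymbol i) (by
    intro x hx
    refine (GrPiece.mk_eq_zero E i _).2 ?_
    have hx' : (x : X) ∈ G (i - 1) := hx
    refine (hE.mem_iff _ _).2 ⟨π ^ (i.toNat * n) • (x : X), ?_, rfl⟩
    have h1 := hE.pow_smul_mem hx'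
    -- An element of lower degree has a spare factor `π ^ n`; for `i ≤ 0` both truncated exponents
    -- are zero.
    have : i.toNat * n = (i.toNat - (i - 1).toNat) * n + (i - 1).toNat * n := by
      rw [← add_mul]
      congr 1
      omega
    rw [this, pow_add, mul_smul]
    exact Submodule.smul_mem _ _ h1)

theorem grPieceMap_mk (i : ℤ) (x : G i) : hE.grPieceMap i (GrPiece.mk G i x) =
    GrPiece.mk E i ⟨_, hE.map_mem (hE.pow_smul_mem x.2)⟩ := rfl

/-- The lower-order term `v` of `x` does not contribute in degree `i`. It is recorded nonetheless,
since the same decomposition is later rescaled into another deformation. -/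
theorem exists_mk_eq {i : ℕ} {x : X} (hx : x ∈ deformationFilt π G n i) :
    ∃ w : G i, (∃ v ∈ deformationFilt π G n (i - 1), x = v + π ^ (i * n) • (w : X)) ∧
      GrPiece.mk E i ⟨_, hE.map_mem hx⟩ = hE.grPieceMap i (GrPiece.mk G i w) := by
  obtain ⟨v, hv, w, hw, rfl⟩ := exists_of_mem_deformationFilt hx
  refine ⟨⟨w, hw⟩, ⟨v, hv, rfl⟩, ?_⟩
  rw [← sub_eq_zero, grPieceMap_mk, ← map_sub, GrPiece.mk_eq_zero]
  change σ _ - σ _ ∈ _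
  rw [← map_sub]
  refine (hE.mem_iff _ _).2 ⟨v, hv, congrArg σ (Subtype.ext ?_)⟩
  simp

theorem grPieceMap_surjective (i : ℤ) : Function.Surjective (hE.grPieceMap i) := by
  intro y
  obtain ⟨⟨s, hs⟩, rfl⟩ := GrPiece.mk_surjective E i y
  obtain ⟨x, hx, rfl⟩ := (hE.mem_iff i s).1 hs
  rcases lt_or_ge i 0 with h | h
  · refine ⟨0, ?_⟩
    rw [map_zero, eq_comm, GrPiece.mk_eq_zero]
    have : x = 0 := by
      rwa [deformationFilt_of_neg h, Submodule.mem_bot] at hx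
    subst this
    change σ 0 ∈ _
    rw [map_zero]
    exact zero_mem _
  · lift i to ℕ using h
    obtain ⟨w, -, hw⟩ := hE.exists_mk_eq hx
    exact ⟨_, hw.symm⟩

/-- The kernel of the map `gr_i X → gr_i (X_n / π X_n)` is generated by the torsion and the
multiples of `π`; in particular it does not depend on `n`. -/
theorem grPieceMap_mk_eq_zero_iff (hX : ∀ x : X, π • x = 0 → x = 0)
    (htors : ∀ i x, x ∈ G i → (∃ N : ℕ, π ^ N • x ∈ G (i - 1)) → π ^ n • x ∈ G (i - 1))
    (hker : ∀ x, σ x = 0 ↔ ∃ y, x = π • y) (i : ℤ) (x : G i) :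
    hE.grPieceMap i (GrPiece.mk G i x) = 0 ↔
      ∃ g ∈ G i, ∃ N : ℕ, π ^ N • ((x : X) - π • g) ∈ G (i - 1) := by
  obtain ⟨x, hx⟩ := x
  rcases lt_or_ge i 0 with h | h
  · obtain rfl : x = 0 := by
      rwa [hE.eq_bot_of_neg i h, Submodule.mem_bot] at hx
    refine iff_of_true ?_ ⟨0, zero_mem _, 0, by simp⟩
    exact map_zero ((hE.grPieceMap i).comp (GrPiece.mk G i))
  lift i to ℕ using h
  rw [grPieceMap_mk, GrPiece.mk_eq_zero]
  change σ _ ∈ _ ↔ _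
  rw [hE.mem_iff]
  change (∃ (y : X) (h : y ∈ deformationFilt π G n (i - 1)), _ = σ ⟨π ^ (i * n) • x, _⟩) ↔ _
  constructor
  · rintro ⟨v, hv, h⟩
    rw [eq_comm, ← sub_eq_zero, ← map_sub, hker] at h
    obtain ⟨⟨y, hy⟩, h⟩ := h
    have h' : π ^ (i * n) • x - v = π • y := congrArg Subtype.val h
    -- A priori `y` has arbitrary degree in `X_n`; torsionfreeness of `gr X_n` bounds it by the
    -- degree of `π y`. The leading coefficient of `y` is then the required `g`.
    have hy' : y ∈ deformationFilt π G n i := by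
      refine mem_deformationFilt_of_smul_mem hE.mono htors hy ?_
      rw [← h']
      exact sub_mem (pow_smul_mem_deformationFilt hx) (deformationFilt_mono π G n (by omega) hv)
    obtain ⟨v', hv', w, hw, rfl⟩ := exists_of_mem_deformationFilt hy'
    refine ⟨w, hw, i * n, deformationFilt_le_filtration (π := π) (n := n) hE.mono _ ?_⟩
    have : π ^ (i * n) • (x - π • w) = v + π • v' := by
      rw [smul_sub, smul_comm _ π w, sub_eq_iff_eq_add, add_assoc, ← smul_add, ← h']
      abel
    rw [this]
    exact add_mem hv (Submodule.smul_mem _ _ hv')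
  · rintro ⟨g, hg, N, hN⟩
    have h1 := htors i _ (sub_mem hx (Submodule.smul_mem _ π hg)) ⟨N, hN⟩
    have h2 : π ^ (i * n) • (x - π • g) ∈ deformationFilt π G n (i - 1) := by
      -- In degree `0` no factor `π ^ n` is available to absorb the torsion, but `G (-1) = 0` and
      -- `X` itself is torsionfree. In degree `i + 1`, one factor `π ^ n` of `π ^ ((i + 1) n)` moves
      -- the element down a step.
      rcases i with - | i
      · rw [hE.eq_bot_of_neg _ (by simp), Submodule.mem_bot] at hN
        have : x - π • g = 0 := by
          clear h1
          induction N with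
          | zero => simpa using hN
          | succ N ih =>
            rw [pow_succ', mul_smul] at hN
            exact ih (hX _ hN)
        rw [this, smul_zero]
        exact zero_mem _
      · have e : ((i + 1 : ℕ) : ℤ) - 1 = i := by push_cast; ring
        rw [e] at h1 ⊢
        have h4 := pow_smul_mem_deformationFilt (π := π) (n := n) h1
        rwa [smul_smul, ← pow_add, ← Nat.succ_mul] at h4
    refine ⟨_, h2, ?_⟩
    rw [eq_comm, ← sub_eq_zero, ← map_sub, hker]
    refine ⟨⟨_, deformationFilt_le π G n _ (pow_smul_mem_deformationFilt hg)⟩, Subtype.ext ?_⟩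
    change π ^ (i * n) • x - π ^ (i * n) • (x - π • g) = π • π ^ (i * n) • g
    rw [smul_sub, sub_sub_cancel, smul_comm]

/-- The map `gr X → gr S` that sends `[x]` to `[σ (π ^ (i n) x)]` in degree `i`. -/
def grMap : Gr G →ₗ[R] Gr E := DirectSum.lmap hE.grPieceMap

theorem grMap_of (i : ℤ) (x : GrPiece G i) :
    hE.grMap (DirectSum.of _ i x) = DirectSum.of _ i (hE.grPieceMap i x) :=
  DirectSum.lmap_of _ _ _

theorem grMap_surjective : Function.Surjective hE.grMap :=
  (DirectSum.lmap_surjective _).2 hE.grPieceMap_surjective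

end IsDeformationImage

/-- Surjective linear maps with the same kernel have isomorphic targets. -/
def LinearMap.equivOfKerEq {N P Q : Type*} [AddCommGroup N] [Module R N] [AddCommGroup P]
    [Module R P] [AddCommGroup Q] [Module R Q] (f : N →ₗ[R] P) (g : N →ₗ[R] Q)
    (hf : Function.Surjective f) (hg : Function.Surjective g)
    (h : LinearMap.ker f = LinearMap.ker g) : P ≃ₗ[R] Q :=
  (f.quotKerEquivOfSurjective hf).symm ≪≫ₗ Submodule.quotEquivOfEq _ _ h ≪≫ₗ
    g.quotKerEquivOfSurjective hg

theorem LinearMap.equivOfKerEq_apply {N P Q : Type*} [AddCommGroup N] [Module R N]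
    [AddCommGroup P] [Module R P] [AddCommGroup Q] [Module R Q] (f : N →ₗ[R] P) (g : N →ₗ[R] Q)
    (hf : Function.Surjective f) (hg : Function.Surjective g)
    (h : LinearMap.ker f = LinearMap.ker g) (x : N) :
    LinearMap.equivOfKerEq f g hf hg h (f x) = g x := by
  have : (f.quotKerEquivOfSurjective hf).symm (f x) = Submodule.Quotient.mk x := by
    rw [LinearEquiv.symm_apply_eq]
    rfl
  simp only [equivOfKerEq, LinearEquiv.trans_apply, this]
  rfl

namespace IsDeformationImage

variable {n₀ : ℕ} {S₀ : Type*} [AddCommGroup S₀] [Module R S₀]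
  {σ₀ : deformation π G n₀ →ₗ[R] S₀} {E₀ : ℤ → Submodule R S₀}
  {σ : deformation π G n →ₗ[R] S} {E : ℤ → Submodule R S}

/-- The degreewise description of the kernel by torsion and multiples of `π` mentions neither
deformation. It requires the torsion bound for both `n₀` and `n`, which is why the bound is assumed
for all `m ≥ n₀`. -/
theorem ker_grMap_eq (hE₀ : IsDeformationImage π G n₀ σ₀ E₀) (hE : IsDeformationImage π G n σ E)
    (hX : ∀ x : X, π • x = 0 → x = 0)
    (htors : ∀ m, n₀ ≤ m →
      ∀ i x, x ∈ G i → (∃ N : ℕ, π ^ N • x ∈ G (i - 1)) → π ^ m • x ∈ G (i - 1))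
    (hker₀ : ∀ x, σ₀ x = 0 ↔ ∃ y, x = π • y) (hker : ∀ x, σ x = 0 ↔ ∃ y, x = π • y)
    (hn : n₀ ≤ n) : LinearMap.ker hE₀.grMap = LinearMap.ker hE.grMap := by
  ext x
  rw [LinearMap.mem_ker, LinearMap.mem_ker, DFinsupp.ext_iff, DFinsupp.ext_iff]
  refine forall_congr' fun i ↦ ?_
  change hE₀.grPieceMap i (x i) = 0 ↔ hE.grPieceMap i (x i) = 0
  obtain ⟨y, hy⟩ := GrPiece.mk_surjective G i (x i)
  rw [← hy, hE₀.grPieceMap_mk_eq_zero_iff hX (htors _ le_rfl) hker₀,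
    hE.grPieceMap_mk_eq_zero_iff hX (htors _ hn) hker]

/-- If `x = v + π ^ (i n₀) w`, then `π ^ (i (n - n₀)) x` has leading term `π ^ (i n) w`. One class
`[w]` thus explains both symbols, and any map compatible with the two surjections matches them. -/
theorem exists_grMap_eq_symbols (hE₀ : IsDeformationImage π G n₀ σ₀ E₀)
    (hE : IsDeformationImage π G n σ E) (hn : n₀ ≤ n) {i : ℕ} {x : X}
    (hx : x ∈ deformationFilt π G n₀ i) :
    ∃ w : Gr G, grSymbol E₀ i ⟨_, hE₀.map_mem hx⟩ = hE₀.grMap w ∧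
      grSymbol E i ⟨_, hE.map_mem (pow_smul_mem_deformationFilt_of_le hn le_rfl hx)⟩ =
        hE.grMap w := by
  obtain ⟨w, ⟨v, hv, rfl⟩, hw⟩ := hE₀.exists_mk_eq hx
  refine ⟨DirectSum.of (GrPiece G) (i : ℤ) (GrPiece.mk G i w), ?_, ?_⟩
  · rw [hE₀.grMap_of, ← hw]
    rfl
  · rw [hE.grMap_of]
    refine congrArg (DirectSum.of (GrPiece E) (i : ℤ)) ?_
    rw [← sub_eq_zero, grPieceMap_mk, ← map_sub, GrPiece.mk_eq_zero]
    change σ _ - σ _ ∈ _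
    rw [← map_sub]
    refine (hE.mem_iff _ _).2 ⟨_, pow_smul_mem_deformationFilt_of_le hn
      (show (i : ℤ) - 1 ≤ i by omega) hv, congrArg σ (Subtype.ext ?_)⟩
    change π ^ (i * (n - n₀)) • v =
      π ^ (i * (n - n₀)) • (v + π ^ (i * n₀) • (w : X)) - π ^ (i * n) • (w : X)
    rw [smul_add, smul_smul, ← pow_add, ← mul_add, Nat.sub_add_cancel hn, add_sub_cancel_right]

end IsDeformationImage

end Slices

/-! ### Products of symbols in associated graded rings and modules. -/

section Multiplicative

variable {R : Type*} [CommRing R] {B : Type*} [Ring B] [Algebra R B] {F : ℤ → Submodule R B}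
  [IsRingFiltration F (fun i ↦ F (i - 1))]
  {N : Type*} [AddCommGroup N] [Module R N] [Module B N] [IsScalarTower R B N]
  {G : ℤ → Submodule R N} [IsModuleFiltration F (fun i ↦ F (i - 1)) G (fun i ↦ G (i - 1))]

theorem of_mk_mul_of_mk {i j : ℤ} (a : F i) (b : F j) :
    (DirectSum.of (GrPiece F) i (GrPiece.mk F i a)) *
      (DirectSum.of (GrPiece F) j (GrPiece.mk F j b)) =
      DirectSum.of (GrPiece F) (i + j) (GrPiece.mk F (i + j)
        ⟨(a : B) * b, SetLike.mul_mem_graded a.2 b.2⟩) :=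
  DirectSum.of_mul_of _ _

theorem of_mk_smul_of_mk {i j : ℤ} (a : F i) (x : G j) :
    (DirectSum.of (GrPiece F) i (GrPiece.mk F i a)) •
      (DirectSum.of (GrPiece G) j (GrPiece.mk G j x)) =
      DirectSum.of (GrPiece G) (i + j) (GrPiece.mk G (i + j)
        ⟨(a : B) • (x : N), smul_mem_filtration F G a.2 x.2⟩) :=
  DirectSum.Gmodule.of_smul_of _ _ _ _

theorem one_eq_of_mk : (1 : Gr F) =
    DirectSum.of (GrPiece F) 0 (GrPiece.mk F 0 ⟨1, SetLike.GradedOne.one_mem⟩) := rfl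

theorem of_mk_eq_of_mk {X : Type*} [AddCommGroup X] [Module R X] {H : ℤ → Submodule R X}
    {i j : ℤ} (h : i = j) (x : H i) (y : H j) (hxy : (x : X) = y) :
    DirectSum.of (GrPiece H) i (GrPiece.mk H i x) =
      DirectSum.of (GrPiece H) j (GrPiece.mk H j y) :=
  DirectSum.of_eq_of_gradedMonoid_eq (GrPiece.sigma_ext H h x y hxy)

theorem Gr.induction {X : Type*} [AddCommGroup X] [Module R X] {H : ℤ → Submodule R X}
    {p : Gr H → Prop} (h0 : p 0) (hadd : ∀ x y, p x → p y → p (x + y))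
    (hmk : ∀ i (x : H i), p (DirectSum.of (GrPiece H) i (GrPiece.mk H i x))) (x : Gr H) : p x := by
  induction x using DirectSum.induction_on with
  | zero => exact h0
  | of i x =>
    obtain ⟨x, rfl⟩ := GrPiece.mk_surjective H i x
    exact hmk i x
  | add x y hx hy => exact hadd x y hx hy

/-- Checked on homogeneous symbols, where it is `R`-linearity of the action on `N`. It makes the
elements of `gr N` killed by a scalar a submodule over `gr B`. -/
theorem Gr.smul_smul_comm (r : R) (a : Gr F) (x : Gr G) : r • a • x = a • r • x := by
  induction a using Gr.induction with
  | h0 => rw [zero_smul, zero_smul, smul_zero]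
  | hadd a b ha hb => rw [add_smul, smul_add, ha, hb, add_smul]
  | hmk i a =>
    induction x using Gr.induction with
    | h0 => simp only [smul_zero]
    | hadd x y hx hy => simp only [smul_add, hx, hy]
    | hmk j x =>
      rw [of_mk_smul_of_mk]
      have h (k : ℤ) (y : G k) : r • DirectSum.of (GrPiece G) k (GrPiece.mk G k y) =
          DirectSum.of (GrPiece G) k (GrPiece.mk G k (r • y)) := by
        rw [map_smul]
        exact (map_smul (DirectSum.lof R ℤ (GrPiece G) k) r _).symm
      rw [h, h, of_mk_smul_of_mk]
      exact of_mk_eq_of_mk rfl _ _ (smul_comm r (a : B) (x : N))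

end Multiplicative

/-! ### Multiplicativity of the comparison maps. -/

namespace IsDeformationImage

variable {R : Type*} [CommRing R] {π : R} {U : Type*} [Ring U] [Algebra R U]
  {F : ℤ → Submodule R U} [IsRingFiltration F (fun i ↦ F (i - 1))] {n : ℕ}
  {S : Type*} [Ring S] [Algebra R S] {σ : deformation π F n →ₗ[R] S} {E : ℤ → Submodule R S}
  [IsRingFiltration E (fun i ↦ E (i - 1))] (hE : IsDeformationImage π F n σ E)

section Ring

variable (hmul : ∀ x y (hx : x ∈ deformation π F n) (hy : y ∈ deformation π F n)
    (hxy : x * y ∈ deformation π F n), σ ⟨x * y, hxy⟩ = σ ⟨x, hx⟩ * σ ⟨y, hy⟩)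

include hmul in
-- The normalising factors multiply correctly: `π ^ ((i + j) n) a b = (π ^ (i n) a)(π ^ (j n) b)`.
-- Negative degrees are split off because truncation to `ℕ` is not additive there; those pieces
-- vanish.
theorem grMap_mul (a b : Gr F) : hE.grMap (a * b) = hE.grMap a * hE.grMap b := by
  induction a using Gr.induction with
  | h0 => simp only [zero_mul, map_zero]
  | hadd a a' ha ha' => simp only [add_mul, map_add, ha, ha']
  | hmk i a =>
    induction b using Gr.induction with
    | h0 => simp only [mul_zero, map_zero]
    | hadd b b' hb hb' => simp only [mul_add, map_add, hb, hb']
    | hmk j b =>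
      obtain ⟨a, ha⟩ := a
      obtain ⟨b, hb⟩ := b
      rcases lt_or_ge i 0 with h | h
      · obtain rfl : a = 0 := by rwa [hE.eq_bot_of_neg i h, Submodule.mem_bot] at ha
        have : (⟨0, ha⟩ : F i) = 0 := rfl
        simp only [this, map_zero, zero_mul]
      rcases lt_or_ge j 0 with h' | h'
      · obtain rfl : b = 0 := by rwa [hE.eq_bot_of_neg j h', Submodule.mem_bot] at hb
        have : (⟨0, hb⟩ : F j) = 0 := rfl
        simp only [this, map_zero, mul_zero]
      rw [of_mk_mul_of_mk, grMap_of, grMap_of, grMap_of, grPieceMap_mk, grPieceMap_mk,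
        grPieceMap_mk, of_mk_mul_of_mk]
      refine of_mk_eq_of_mk rfl _ _ ?_
      change σ _ = σ _ * σ _
      have e : π ^ ((i + j).toNat * n) • (a * b) =
          (π ^ (i.toNat * n) • a) * (π ^ (j.toNat * n) • b) := by
        rw [Int.toNat_add h h', smul_mul_smul_comm, add_mul, pow_add]
      have h3 : (π ^ (i.toNat * n) • a) * (π ^ (j.toNat * n) • b) ∈ deformation π F n := by
        rw [← e]
        exact deformationFilt_le π F n _ (hE.pow_smul_mem (SetLike.mul_mem_graded ha hb))
      rw [← hmul _ _ _ _ h3]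
      exact congrArg σ (Subtype.ext e)

theorem grMap_one (hone : ∀ h, σ ⟨1, h⟩ = 1) : hE.grMap 1 = 1 := by
  rw [one_eq_of_mk, grMap_of, grPieceMap_mk, one_eq_of_mk]
  refine of_mk_eq_of_mk rfl _ _ ?_
  have e : π ^ ((0 : ℤ).toNat * n) • (1 : U) = 1 := by simp
  simp only [e, hone]

end Ring

variable {M : Type*} [AddCommGroup M] [Module R M] [Module U M] [IsScalarTower R U M]
  {G : ℤ → Submodule R M} [IsModuleFiltration F (fun i ↦ F (i - 1)) G (fun i ↦ G (i - 1))]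
  {T : Type*} [AddCommGroup T] [Module R T] [Module S T] [IsScalarTower R S T]
  {τ : deformation π G n →ₗ[R] T} {H : ℤ → Submodule R T}
  [IsModuleFiltration E (fun i ↦ E (i - 1)) H (fun i ↦ H (i - 1))]
  (hH : IsDeformationImage π G n τ H)

theorem grMap_smul (hsmul : ∀ (u : U) (m : M) (hu : u ∈ deformation π F n)
      (hm : m ∈ deformation π G n) (hum : u • m ∈ deformation π G n),
      τ ⟨u • m, hum⟩ = σ ⟨u, hu⟩ • τ ⟨m, hm⟩) (a : Gr F) (x : Gr G) :
    hH.grMap (a • x) = hE.grMap a • hH.grMap x := by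
  induction a using Gr.induction with
  | h0 => rw [zero_smul, map_zero, map_zero, zero_smul]
  | hadd a a' ha ha' => rw [add_smul, map_add, ha, ha', map_add, add_smul]
  | hmk i a =>
    induction x using Gr.induction with
    | h0 => rw [smul_zero, map_zero, smul_zero]
    | hadd b b' hb hb' => rw [smul_add, map_add, hb, hb', map_add, smul_add]
    | hmk j b =>
      obtain ⟨a, ha⟩ := a
      obtain ⟨b, hb⟩ := b
      rcases lt_or_ge i 0 with h | h
      · obtain rfl : a = 0 := by rwa [hE.eq_bot_of_neg i h, Submodule.mem_bot] at ha
        have : (⟨0, ha⟩ : F i) = 0 := rfl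
        rw [this, map_zero, map_zero, zero_smul, map_zero, map_zero, zero_smul]
      rcases lt_or_ge j 0 with h' | h'
      · obtain rfl : b = 0 := by rwa [hH.eq_bot_of_neg j h', Submodule.mem_bot] at hb
        have : (⟨0, hb⟩ : G j) = 0 := rfl
        rw [this, map_zero, map_zero, smul_zero, map_zero, smul_zero]
      rw [of_mk_smul_of_mk, grMap_of, grMap_of, grMap_of, grPieceMap_mk, grPieceMap_mk,
        grPieceMap_mk, of_mk_smul_of_mk]
      refine of_mk_eq_of_mk rfl _ _ ?_
      change τ _ = σ _ • τ _
      have e : π ^ ((i + j).toNat * n) • (a • b) =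
          (π ^ (i.toNat * n) • a) • (π ^ (j.toNat * n) • b) := by
        rw [Int.toNat_add h h', smul_smul_smul_comm, add_mul, pow_add, smul_eq_mul]
      have h3 : (π ^ (i.toNat * n) • a) • (π ^ (j.toNat * n) • b) ∈ deformation π G n := by
        rw [← e]
        exact deformationFilt_le π G n _ (hH.pow_smul_mem (smul_mem_filtration F G ha hb))
      rw [← hsmul _ _ _ _ h3]
      exact congrArg τ (Subtype.ext e)

end IsDeformationImage

/-! ### Noetherianity lifts from the associated graded ring. -/

section Noetherian

variable {R : Type*} [CommRing R] {B : Type*} [Ring B] [Algebra R B] (F : ℤ → Submodule R B)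
  [IsRingFiltration F (fun i ↦ F (i - 1))]

/-- The left ideal of `gr B` generated by the symbols of the elements of a left ideal of `B`. -/
def symbolIdeal (I : Ideal B) : Ideal (Gr F) :=
  Ideal.span {s | ∃ (i : ℤ) (b : F i), (b : B) ∈ I ∧ s = DirectSum.of (GrPiece F) i (GrPiece.mk F i b)}

theorem symbolIdeal_mono : Monotone (symbolIdeal F) := fun I J h ↦ by
  refine Ideal.span_mono ?_
  rintro _ ⟨i, b, hb, rfl⟩
  exact ⟨i, b, h hb, rfl⟩

variable {F} in
-- A homogeneous multiple of the symbol of `b` is represented by a multiple of `b`, and in a fixed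
-- degree classes add like their representatives. So the symbols of `I` already exhaust the
-- homogeneous components of the ideal they generate.
theorem exists_mk_of_mem_symbolIdeal {I : Ideal B} {x : Gr F} (hx : x ∈ symbolIdeal F I) (i : ℤ) :
    ∃ b : F i, (b : B) ∈ I ∧ x i = GrPiece.mk F i b := by
  have hadd {x y : Gr F} (hx : ∀ i, ∃ b : F i, (b : B) ∈ I ∧ x i = GrPiece.mk F i b)
      (hy : ∀ i, ∃ b : F i, (b : B) ∈ I ∧ y i = GrPiece.mk F i b) (i : ℤ) :
      ∃ b : F i, (b : B) ∈ I ∧ (x + y) i = GrPiece.mk F i b := by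
    obtain ⟨a, ha, hx⟩ := hx i
    obtain ⟨b, hb, hy⟩ := hy i
    exact ⟨a + b, I.add_mem ha hb, by rw [DirectSum.add_apply, hx, hy, map_add]⟩
  have h0 (i : ℤ) : ∃ b : F i, (b : B) ∈ I ∧ (0 : Gr F) i = GrPiece.mk F i b :=
    ⟨0, I.zero_mem, by rw [map_zero]; rfl⟩
  revert i
  induction hx using Submodule.closure_induction with
  | zero => exact h0
  | add x y _ _ hx hy => exact hadd hx hy
  | smul_mem a s hs =>
    obtain ⟨j, b, hb, rfl⟩ := hs
    induction a using Gr.induction with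
    | h0 => rw [zero_smul]; exact h0
    | hadd a a' ha ha' => rw [add_smul]; exact hadd ha ha'
    | hmk k a =>
      rw [smul_eq_mul, of_mk_mul_of_mk]
      intro i
      by_cases h : k + j = i
      · subst h
        exact ⟨_, I.mul_mem_left _ hb, DirectSum.of_eq_same _ _⟩
      · rw [DirectSum.of_eq_of_ne _ _ _ (Ne.symm h)]
        exact h0 i

variable {F} in
-- Subtracting from `b ∈ I` an element of `J` with the same symbol lowers the degree; the process
-- stops because the filtration vanishes in negative degrees.
theorem le_of_symbolIdeal_le (hneg : ∀ i < 0, F i = ⊥) (hex : ∀ b, ∃ i, b ∈ F i) {I J : Ideal B}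
    (hJI : J ≤ I) (h : symbolIdeal F I ≤ symbolIdeal F J) : I ≤ J := by
  have key (d : ℕ) : ∀ b ∈ I, b ∈ F (d - 1) → b ∈ J := by
    induction d with
    | zero =>
      intro b _ hb
      rw [hneg _ (by simp), Submodule.mem_bot] at hb
      rw [hb]
      exact J.zero_mem
    | succ d ih =>
      intro b hbI hb
      rw [show ((d + 1 : ℕ) : ℤ) - 1 = d by push_cast; ring] at hb
      obtain ⟨c, hc, hbc⟩ := exists_mk_of_mem_symbolIdeal
        (h (Ideal.subset_span ⟨d, ⟨b, hb⟩, hbI, rfl⟩)) d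
      rw [DirectSum.of_eq_same, ← sub_eq_zero, ← map_sub, GrPiece.mk_eq_zero] at hbc
      have h1 := ih _ (I.sub_mem hbI (hJI hc)) hbc
      simpa using J.add_mem h1 hc
  intro b hb
  obtain ⟨i, hi⟩ := hex b
  refine key (i.toNat + 1) b hb (IsFiltration.mono (F := F) (F_lt := fun i ↦ F (i - 1)) ?_ hi)
  have := Int.self_le_toNat i
  push_cast
  omega

theorem isNoetherianRing_of_gr (hneg : ∀ i < 0, F i = ⊥) (hex : ∀ b, ∃ i, b ∈ F i)
    (h : IsNoetherianRing (Gr F)) : IsNoetherianRing B := by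
  have : WellFoundedGT (Ideal (Gr F)) := isNoetherian_iff'.1 h
  -- Strict inclusions of left ideals give strict inclusions of symbol ideals, so the ascending
  -- chain condition is pulled back.
  refine isNoetherian_iff'.2 (StrictMono.wellFoundedGT (f := symbolIdeal F) ?_)
  intro J I hlt
  exact lt_of_le_not_ge (symbolIdeal_mono F hlt.le)
    fun h ↦ hlt.not_ge (le_of_symbolIdeal_le hneg hex hlt.le h)

end Noetherian

/-! ### Deformable algebras and their deformations. -/

section DeformableAlgebra

variable {R : Type*} [CommRing R] {π : R} {U : Type*} [Ring U] [Algebra R U]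
  {F : ℤ → Submodule R U} [IsRingFiltration F (fun i ↦ F (i - 1))]

theorem filtration_monotone : Monotone F := IsFiltration.mono (F_lt := fun i ↦ F (i - 1))

/-- A flat module over a domain is torsionfree, so `gr U` has no `π`-torsion and the torsion bound
holds for `U` with any exponent. -/
theorem IsDeformable.mem_of_pow_smul_mem [IsDomain R] (hF : IsDeformable F) (hπ : Irreducible π)
    {i : ℤ} {x : U} (hx : x ∈ F i) {N : ℕ} (h : π ^ N • x ∈ F (i - 1)) : x ∈ F (i - 1) := by
  have := hF.flat
  have htf : Module.IsTorsionFree R (Gr F) := inferInstance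
  have h1 : π ^ N • grSymbol F i ⟨x, hx⟩ = 0 := by
    rw [← map_smul, grSymbol, LinearMap.comp_apply,
      (GrPiece.mk_eq_zero F i (π ^ N • ⟨x, hx⟩)).2 h, map_zero]
  rw [smul_eq_zero_iff_right (pow_ne_zero _ hπ.ne_zero)] at h1
  have h2 : GrPiece.mk F i ⟨x, hx⟩ = 0 :=
    DirectSum.of_injective (β := GrPiece F) i (h1.trans (map_zero _).symm)
  exact (GrPiece.mk_eq_zero F i _).1 h2

variable (π F) in
/-- The identification of the submodule `U_n` with the subalgebra `U_n`. -/
def deformationToAlg (n : ℕ) : deformation π F n →ₗ[R] deformedAlg π F n where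
  toFun x := ⟨x, x.2⟩
  map_add' _ _ := rfl
  map_smul' _ _ := rfl

theorem IsDeformable.isDeformationImage (hF : IsDeformable F) {n : ℕ} {S : Type*}
    [AddCommGroup S] [Module R S] (f : deformedAlg π F n →ₗ[R] S) :
    IsDeformationImage π F n (f ∘ₗ deformationToAlg π F n)
      (fun i ↦ (deformedAlgFilt π F n i).map f) where
  mono := filtration_monotone
  eq_bot_of_neg := hF.eq_bot_of_neg
  mem_iff i s := by
    constructor
    · rintro ⟨x, hx, rfl⟩
      exact ⟨x, hx, rfl⟩
    · rintro ⟨x, hx, rfl⟩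
      exact ⟨⟨x, deformationFilt_le π F n i hx⟩, hx, rfl⟩

theorem IsDeformable.isDeformationImage_deformationToAlg (hF : IsDeformable F) (n : ℕ) :
    IsDeformationImage π F n (deformationToAlg π F n) (deformedAlgFilt π F n) where
  mono := filtration_monotone
  eq_bot_of_neg := hF.eq_bot_of_neg
  mem_iff i s := by
    constructor
    · intro hs
      exact ⟨s, hs, rfl⟩
    · rintro ⟨x, hx, rfl⟩
      exact hx

/-- The comparison map before reduction modulo `π`, `[u] ↦ [π ^ (i n) u]`, is a surjective ring
homomorphism `gr U → gr U_n`. -/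
theorem IsDeformable.isNoetherianRing_deformedAlg (hF : IsDeformable F)
    (hnoeth : IsNoetherianRing (Gr F)) (n : ℕ) : IsNoetherianRing (deformedAlg π F n) := by
  have hE := hF.isDeformationImage_deformationToAlg (π := π) n
  let Θ : Gr F →+* Gr (deformedAlgFilt π F n) :=
    { hE.grMap.toAddMonoidHom with
      map_one' := hE.grMap_one fun _ ↦ rfl
      map_mul' := hE.grMap_mul fun _ _ _ _ _ ↦ rfl }
  refine isNoetherianRing_of_gr (deformedAlgFilt π F n) (fun i hi ↦ ?_)
    (deformedAlgFilt_exhaustive π F n) (isNoetherianRing_of_surjective _ _ Θ hE.grMap_surjective)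
  rw [eq_bot_iff]
  intro x hx
  have hx' : (x : U) ∈ deformationFilt π F n i := hx
  rw [deformationFilt_of_neg hi] at hx'
  exact Subtype.ext hx'

end DeformableAlgebra

/-! ### Good filtrations: existence, generators and bounded torsion. -/

section GoodFiltration

variable {R : Type*} [CommRing R] {π : R} {U : Type*} [Ring U] [Algebra R U]
  {F : ℤ → Submodule R U} [IsRingFiltration F (fun i ↦ F (i - 1))]
  {M : Type*} [AddCommGroup M] [Module R M] [Module U M] [IsScalarTower R U M]
  {G : ℤ → Submodule R M} {r : ℕ} {k : Fin r → ℤ} {m : Fin r → M}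

theorem mem_iSup_map_toSpanSingleton_iff {H : Fin r → Submodule R U} {x : M} :
    x ∈ ⨆ j, (H j).map ((LinearMap.toSpanSingleton U M (m j)).restrictScalars R) ↔
      ∃ u : Fin r → U, (∀ j, u j ∈ H j) ∧ x = ∑ j, u j • m j := by
  constructor
  · intro h
    induction h using Submodule.iSup_induction' with
    | mem j x hx =>
      obtain ⟨u, hu, rfl⟩ := hx
      refine ⟨Pi.single j u, fun l ↦ ?_, ?_⟩
      · by_cases h : l = j
        · subst h; rwa [Pi.single_eq_same]
        · rw [Pi.single_eq_of_ne h]; exact zero_mem _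
      · rw [Finset.sum_eq_single j]
        · rw [Pi.single_eq_same]; rfl
        · intro l _ h
          rw [Pi.single_eq_of_ne h, zero_smul]
        · simp
    | zero => exact ⟨0, fun _ ↦ zero_mem _, by simp⟩
    | add x y _ _ hx hy =>
      obtain ⟨u, hu, rfl⟩ := hx
      obtain ⟨v, hv, rfl⟩ := hy
      exact ⟨u + v, fun j ↦ add_mem (hu j) (hv j), by simp [add_smul, Finset.sum_add_distrib]⟩
  · rintro ⟨u, hu, rfl⟩
    exact Submodule.sum_mem _ fun j _ ↦ Submodule.mem_iSup_of_mem j ⟨u j, hu j, rfl⟩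

theorem IsDeformable.exists_isGoodFiltration (hF : IsDeformable F) [Module.Finite U M] :
    ∃ G : ℤ → Submodule R M, IsGoodFiltration F G := by
  obtain ⟨r, m, hm⟩ := Module.Finite.exists_fin (R := U) (M := M)
  -- All generators are placed in degree `0`.
  refine ⟨fun i ↦ ⨆ j, (F i).map ((LinearMap.toSpanSingleton U M (m j)).restrictScalars R),
    ?_, ?_, ?_, r, 0, m, ?_⟩
  · have : SetLike.GradedSMul F
        (fun i ↦ ⨆ j, (F i).map ((LinearMap.toSpanSingleton U M (m j)).restrictScalars R)) := by
      refine ⟨fun {i j a x} ha hx ↦ ?_⟩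
      rw [mem_iSup_map_toSpanSingleton_iff] at hx ⊢
      obtain ⟨u, hu, rfl⟩ := hx
      exact ⟨fun l ↦ a * u l, fun l ↦ SetLike.mul_mem_graded ha (hu l), by
        simp [Finset.smul_sum, mul_smul]⟩
    have hmono : Monotone
        (fun i ↦ ⨆ j, (F i).map ((LinearMap.toSpanSingleton U M (m j)).restrictScalars R)) :=
      fun i j h ↦ iSup_mono fun l ↦ Submodule.map_mono (filtration_monotone h)
    exact { toIsFiltration := IsFiltration.mk_int _ hmono, toGradedSMul := this }
  · intro i hi
    simp [hF.eq_bot_of_neg i hi]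
  · intro x
    have hx : x ∈ Submodule.span U (Set.range m) := hm ▸ Submodule.mem_top
    obtain ⟨u, rfl⟩ := (Submodule.mem_span_range_iff_exists_fun U).1 hx
    choose i hi using fun j ↦ hF.exhaustive (u j)
    refine ⟨∑ j, (i j).toNat, mem_iSup_map_toSpanSingleton_iff.2 ⟨u, fun j ↦ ?_, rfl⟩⟩
    refine filtration_monotone ?_ (hi j)
    refine (Int.self_le_toNat _).trans ?_
    exact_mod_cast Finset.single_le_sum (f := fun j ↦ (i j).toNat) (fun _ _ ↦ Nat.zero_le _)
      (Finset.mem_univ j)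
  · intro i
    simp

theorem mem_of_generators
    (hG : ∀ i, G i = ⨆ j, (F (i - k j)).map ((LinearMap.toSpanSingleton U M (m j)).restrictScalars R))
    (j : Fin r) : m j ∈ G (k j) := by
  rw [hG]
  refine Submodule.mem_iSup_of_mem j ⟨1, ?_, one_smul _ _⟩
  rw [sub_self]
  exact SetLike.GradedOne.one_mem

theorem IsGoodFiltration.monotone (hG : IsGoodFiltration F G) : Monotone G :=
  hG.isModuleFiltration.mono

theorem IsGoodFiltration.pow_smul_generator_mem (h : IsGoodFiltration F G)
    (hG : ∀ i, G i = ⨆ j, (F (i - k j)).map ((LinearMap.toSpanSingleton U M (m j)).restrictScalars R))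
    (n : ℕ) (j : Fin r) : π ^ ((k j).toNat * n) • m j ∈ deformation π G n :=
  deformationFilt_le π G n _
    (pow_smul_mem_deformationFilt (h.monotone (Int.self_le_toNat _) (mem_of_generators hG j)))

/-- The weight `π ^ (i n)` splits as `π ^ ((i - k_j) n)`, which puts the coefficient `u_j ∈
F_{i-k_j} U` into `U_n`, times `π ^ (k_j n)`, which puts `m_j` into `M_n`. -/
theorem IsGoodFiltration.exists_of_mem_deformation (hF : IsDeformable F)
    (h : IsGoodFiltration F G)
    (hG : ∀ i, G i = ⨆ j, (F (i - k j)).map ((LinearMap.toSpanSingleton U M (m j)).restrictScalars R))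
    {n : ℕ} {x : M} (hx : x ∈ deformation π G n) :
    ∃ u : Fin r → deformedAlg π F n, x = ∑ j, (u j : U) • π ^ ((k j).toNat * n) • m j := by
  induction hx using Submodule.iSup_induction' with
  | mem i x hx =>
    obtain ⟨x, hx, rfl⟩ := hx
    have hx' : x ∈ G i := hx
    rw [hG, mem_iSup_map_toSpanSingleton_iff] at hx'
    obtain ⟨u, hu, rfl⟩ := hx'
    have key (j : Fin r) : ∃ v : deformedAlg π F n,
        π ^ (i * n) • u j • m j = (v : U) • π ^ ((k j).toNat * n) • m j := by
      -- The splitting needs `0 ≤ k_j ≤ i`. If `k_j < 0` then `m_j ∈ G (k_j) = 0`, and if `i < k_j`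
      -- the coefficient lies in a negative step of `F`.
      rcases lt_or_ge (k j) 0 with h1 | h1
      · have : m j = 0 := by
          have := mem_of_generators hG j
          rwa [h.eq_bot_of_neg _ h1, Submodule.mem_bot] at this
        exact ⟨0, by simp [this]⟩
      rcases lt_or_ge (i : ℤ) (k j) with h2 | h2
      · have : u j = 0 := by
          have := hu j
          rwa [hF.eq_bot_of_neg _ (by omega), Submodule.mem_bot] at this
        exact ⟨0, by simp [this]⟩
      · have h3 : u j ∈ F ((i - (k j).toNat : ℕ) : ℤ) :=
          filtration_monotone (by omega) (hu j)
        refine ⟨⟨_, deformationFilt_le π F n _ (pow_smul_mem_deformationFilt h3)⟩, ?_⟩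
        change _ = (π ^ ((i - (k j).toNat) * n) • u j) • π ^ ((k j).toNat * n) • m j
        rw [smul_smul_smul_comm, smul_eq_mul, ← pow_add, ← add_mul, Nat.sub_add_cancel (by omega)]
    choose v hv using key
    refine ⟨v, ?_⟩
    change π ^ (i * n) • ∑ j, u j • m j = _
    rw [Finset.smul_sum]
    exact Finset.sum_congr rfl fun j _ ↦ hv j
  | zero => exact ⟨0, by simp⟩
  | add x y _ _ hx hy =>
    obtain ⟨u, rfl⟩ := hx
    obtain ⟨v, rfl⟩ := hy
    exact ⟨u + v, by simp [add_smul, Finset.sum_add_distrib]⟩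

theorem IsGoodFiltration.span_generators (h : IsGoodFiltration F G)
    (hG : ∀ i, G i = ⨆ j, (F (i - k j)).map ((LinearMap.toSpanSingleton U M (m j)).restrictScalars R))
    (x : M) : ∃ u : Fin r → U, x = ∑ j, u j • m j := by
  obtain ⟨i, hi⟩ := h.exhaustive x
  rw [hG, mem_iSup_map_toSpanSingleton_iff] at hi
  obtain ⟨u, -, hu⟩ := hi
  exact ⟨u, hu⟩

/-- The symbols of the `m_j` in degrees `k_j` generate, since each homogeneous element has the form
`∑ u_j m_j` with `u_j` of degree at most `i - k_j`. -/
theorem IsGoodFiltration.finite_gr (h : IsGoodFiltration F G)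
    [IsModuleFiltration F (fun i ↦ F (i - 1)) G (fun i ↦ G (i - 1))] :
    Module.Finite (Gr F) (Gr G) := by
  obtain ⟨r, k, m, hG⟩ := h.exists_generators
  refine Module.finite_def.2 ((Submodule.fg_def (R := Gr F)).2
    ⟨Set.range fun j : Fin r ↦ DirectSum.of (GrPiece G) (k j) (GrPiece.mk G (k j)
      ⟨m j, mem_of_generators hG j⟩), Set.finite_range _, eq_top_iff.2 ?_⟩)
  rintro x -
  induction x using Gr.induction with
  | h0 => exact Submodule.zero_mem _
  | hadd x y hx hy => exact Submodule.add_mem _ hx hy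
  | hmk i x =>
    obtain ⟨x, hx⟩ := x
    have hx' := hx
    rw [hG, mem_iSup_map_toSpanSingleton_iff] at hx'
    obtain ⟨u, hu, rfl⟩ := hx'
    have hmem (j : Fin r) : u j • m j ∈ G i := by
      have := smul_mem_filtration F G (hu j) (mem_of_generators hG j)
      rwa [sub_add_cancel] at this
    have : (⟨∑ j, u j • m j, hx⟩ : G i) = ∑ j, ⟨u j • m j, hmem j⟩ := by
      ext; simp
    rw [this, map_sum, map_sum]
    refine Submodule.sum_mem _ fun j _ ↦ ?_
    have e : DirectSum.of (GrPiece G) i (GrPiece.mk G i ⟨u j • m j, hmem j⟩) =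
        DirectSum.of (GrPiece F) (i - k j) (GrPiece.mk F _ ⟨u j, hu j⟩) •
          DirectSum.of (GrPiece G) (k j) (GrPiece.mk G (k j) ⟨m j, mem_of_generators hG j⟩) := by
      rw [of_mk_smul_of_mk]
      exact of_mk_eq_of_mk (by ring) _ _ rfl
    rw [e]
    exact Submodule.smul_mem _ _ (Submodule.subset_span ⟨j, rfl⟩)

variable (F G) in
/-- The submodule of `gr M` of the elements killed by `s`. -/
def grTorsionBy [IsModuleFiltration F (fun i ↦ F (i - 1)) G (fun i ↦ G (i - 1))] (s : R) :
    Submodule (Gr F) (Gr G) where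
  carrier := {x | s • x = 0}
  add_mem' {x y} hx hy := by
    rw [Set.mem_ofPred_eq] at *
    rw [smul_add, hx, hy, add_zero]
  zero_mem' := smul_zero s
  smul_mem' a x hx := by
    rw [Set.mem_ofPred_eq] at *
    rw [Gr.smul_smul_comm, hx, smul_zero]

/-- The submodules of `gr M` killed by `π ^ n` form an ascending chain in a noetherian module, so it
stabilises; the bound is uniform in the degree `i`. -/
theorem IsGoodFiltration.exists_torsion_bound (h : IsGoodFiltration F G)
    (hnoeth : IsNoetherianRing (Gr F)) (π : R) : ∃ n₀ : ℕ, ∀ n ≥ n₀, ∀ i x, x ∈ G i →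
      (∃ N : ℕ, π ^ N • x ∈ G (i - 1)) → π ^ n • x ∈ G (i - 1) := by
  have := h.isModuleFiltration
  have := h.finite_gr
  have hN : IsNoetherian (Gr F) (Gr G) := isNoetherian_of_isNoetherianRing_of_finite _ _
  let f : ℕ →o Submodule (Gr F) (Gr G) :=
    { toFun := fun n ↦ grTorsionBy F G (π ^ n)
      monotone' := by
        refine monotone_nat_of_le_succ fun n x hx ↦ ?_
        have hx' : π ^ n • x = 0 := hx
        change π ^ (n + 1) • x = 0
        rw [pow_succ', mul_smul, hx', smul_zero] }
  obtain ⟨n₀, hn₀⟩ := monotone_stabilizes_iff_noetherian.2 hN f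
  refine ⟨n₀, fun n hn i x hx ⟨N, hN⟩ ↦ ?_⟩
  have hmk (l : ℕ) : π ^ l • grSymbol G i ⟨x, hx⟩ = 0 ↔ π ^ l • x ∈ G (i - 1) := by
    rw [← map_smul]
    change DirectSum.of (GrPiece G) i (GrPiece.mk G i (π ^ l • ⟨x, hx⟩)) = 0 ↔ _
    rw [← map_zero (DirectSum.of (GrPiece G) i), (DirectSum.of_injective i).eq_iff,
      GrPiece.mk_eq_zero]
    rfl
  rw [← hmk] at hN ⊢
  -- The index `max n N` is large enough both to contain the given torsion element and to lie in the
  -- stable range; stability then brings it back to `n`.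
  have h1 : grSymbol G i ⟨x, hx⟩ ∈ f (max n N) := f.monotone (le_max_right n N) hN
  rw [← hn₀ _ (hn.trans (le_max_left n N)), hn₀ _ hn] at h1
  exact h1

end GoodFiltration

/-! ### Base change along a homomorphism of noncommutative algebras. -/

noncomputable section BaseChangeLemmas

variable {R : Type*} [CommRing R] {U : Type*} [Ring U] [Algebra R U] {A : Type*} [Ring A]
  [Algebra R A] (f : U →ₐ[R] A) {M : Type*} [AddCommGroup M] [Module R M] [Module U M]

theorem toBaseChange_smul (u : U) (m : M) :
    toBaseChange f M (u • m) = f u • toBaseChange f M m := by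
  refine ((Submodule.Quotient.eq _).2 ?_).symm
  refine Submodule.subset_span ⟨1, u, m, ?_⟩
  have : f u • ((1 : A) ⊗ₜ[R] m) = f u ⊗ₜ[R] m := by
    rw [TensorProduct.smul_tmul', smul_eq_mul, mul_one]
  rw [one_mul, ← this]
  rfl

theorem span_range_toBaseChange :
    Submodule.span A (Set.range (toBaseChange f M)) = ⊤ := by
  rw [eq_top_iff]
  rintro x -
  obtain ⟨x, rfl⟩ := Submodule.Quotient.mk_surjective _ x
  induction x with
  | zero => exact Submodule.zero_mem _
  | add x y hx hy => exact Submodule.add_mem _ hx hy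
  | tmul a m =>
    have : (a ⊗ₜ[R] m : A ⊗[R] M) = a • (1 : A) ⊗ₜ[R] m := by
      rw [TensorProduct.smul_tmul', smul_eq_mul, mul_one]
    rw [this]
    change a • toBaseChange f M m ∈ Submodule.span A (Set.range (toBaseChange f M))
    exact Submodule.smul_mem _ a (Submodule.subset_span ⟨m, rfl⟩)

theorem baseChange_finite [Module.Finite U M] : Module.Finite A (BaseChange f M) := by
  obtain ⟨r, m, hm⟩ := Module.Finite.exists_fin (R := U) (M := M)
  refine Module.finite_def.2 ((Submodule.fg_def (R := A)).2
    ⟨Set.range fun j ↦ toBaseChange f M (m j), Set.finite_range _, ?_⟩)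
  rw [eq_top_iff, ← span_range_toBaseChange f, Submodule.span_le]
  rintro _ ⟨x, rfl⟩
  have hx : x ∈ Submodule.span U (Set.range m) := hm ▸ Submodule.mem_top
  obtain ⟨u, rfl⟩ := (Submodule.mem_span_range_iff_exists_fun U).1 hx
  rw [map_sum]
  refine Submodule.sum_mem _ fun j _ ↦ ?_
  rw [toBaseChange_smul]
  exact Submodule.smul_mem _ _ (Submodule.subset_span ⟨j, rfl⟩)

/-- The universal property of `A ⊗_U M`, needed to map it to the quotient of `A ^ r` by the extended
relations. -/
theorem exists_baseChange_lift {W : Type*} [AddCommGroup W] [Module R W] [Module A W]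
    [IsScalarTower R A W] (φ : M →ₗ[R] W) (hφ : ∀ (u : U) m, φ (u • m) = f u • φ m) :
    ∃ Φ : BaseChange f M →ₗ[A] W, ∀ m, Φ (toBaseChange f M m) = φ m := by
  let ψ : A ⊗[R] M →ₗ[A] W := TensorProduct.AlgebraTensorModule.lift
    { toFun := fun a ↦ a • φ
      map_add' := fun a b ↦ add_smul a b φ
      map_smul' := fun a b ↦ mul_smul a b φ }
  have hψ (a : A) (m : M) : ψ (a ⊗ₜ m) = a • φ m := rfl
  refine ⟨Submodule.liftQ _ ψ (Submodule.span_le.2 ?_), fun m ↦ ?_⟩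
  · rintro _ ⟨a, u, m, rfl⟩
    change ψ _ = 0
    rw [map_sub, hψ, hψ, hφ, mul_smul, sub_self]
  · change ψ (1 ⊗ₜ m) = _
    rw [hψ, one_smul]

/-- Right exactness of the base change: the relations between the elements `1 ⊗ m_j` are generated
by the relations between the `m_j`. -/
theorem mem_span_relations_of_sum_eq_zero [IsScalarTower R U M] {r : ℕ} {m : Fin r → M}
    (hm : ∀ x : M, ∃ u : Fin r → U, x = ∑ j, u j • m j) {a : Fin r → A}
    (ha : ∑ j, a j • toBaseChange f M (m j) = 0) :
    a ∈ Submodule.span A {w : Fin r → A | ∃ u : Fin r → U, ∑ j, u j • m j = 0 ∧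
      w = fun j ↦ f (u j)} := by
  set Q := Submodule.span A {w : Fin r → A | ∃ u : Fin r → U, ∑ j, u j • m j = 0 ∧
      w = fun j ↦ f (u j)}
  let p : (Fin r → U) →ₗ[R] M :=
    { toFun := fun u ↦ ∑ j, u j • m j
      map_add' := fun u v ↦ by simp [add_smul, Finset.sum_add_distrib]
      map_smul' := fun c u ↦ by simp [Finset.smul_sum] }
  have hp : Function.Surjective p := fun x ↦ by
    obtain ⟨u, rfl⟩ := hm x
    exact ⟨u, rfl⟩
  let q : (Fin r → U) →ₗ[R] (Fin r → A) ⧸ Q :=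
    (Q.mkQ.restrictScalars R).comp
      (LinearMap.pi fun j ↦ f.toLinearMap ∘ₗ LinearMap.proj j)
  have hq (u : Fin r → U) : q u = Q.mkQ fun j ↦ f (u j) := rfl
  have hpq : LinearMap.ker p ≤ LinearMap.ker q := by
    intro u hu
    rw [LinearMap.mem_ker, hq, Submodule.mkQ_apply, Submodule.Quotient.mk_eq_zero]
    exact Submodule.subset_span ⟨u, hu, rfl⟩
  -- Writing an element of `M` as `∑ u_j m_j` determines `(f u_j)` modulo `Q`. The induced map on `A
  -- ⊗_U M` sends `1 ⊗ m_j` to the `j`-th basis class, hence sends the given vanishing sum to the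
  -- class of `a`.
  let φ : M →ₗ[R] (Fin r → A) ⧸ Q :=
    (Submodule.liftQ _ q hpq).comp (p.quotKerEquivOfSurjective hp).symm.toLinearMap
  have hφ (u : Fin r → U) : φ (p u) = q u := by
    have : (p.quotKerEquivOfSurjective hp).symm (p u) = Submodule.Quotient.mk u := by
      rw [LinearEquiv.symm_apply_eq]
      rfl
    simp only [φ, LinearMap.comp_apply, LinearEquiv.coe_coe, this]
    rfl
  obtain ⟨Φ, hΦ⟩ := exists_baseChange_lift f φ (by
    intro u x
    obtain ⟨v, rfl⟩ := hp x
    have : u • p v = p (u • v) := by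
      change u • ∑ j, v j • m j = ∑ j, (u • v j) • m j
      simp [Finset.smul_sum, mul_smul]
    rw [this, hφ, hφ, hq, hq, ← map_smul]
    congr 1
    ext j
    exact map_mul f _ _)
  have h1 := congrArg Φ ha
  rw [map_sum, map_zero] at h1
  have h2 (j : Fin r) : Φ (a j • toBaseChange f M (m j)) = Q.mkQ (Pi.single j (a j)) := by
    have : m j = p (Pi.single j 1) := by
      change _ = ∑ l, (Pi.single j 1 : Fin r → U) l • m l
      rw [Finset.sum_eq_single j]
      · rw [Pi.single_eq_same, one_smul]
      · intro l _ h
        rw [Pi.single_eq_of_ne h, zero_smul]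
      · simp
    rw [map_smul, hΦ, this, hφ, hq, ← map_smul]
    congr 1
    ext l
    by_cases h : l = j
    · subst h; simp
    · simp [Pi.single_eq_of_ne h]
  simp only [h2] at h1
  rw [← map_sum, Finset.univ_sum_single, Submodule.mkQ_apply, Submodule.Quotient.mk_eq_zero] at h1
  exact h1

/-- Since `π` acts invertibly on `A`, rescaling the coordinates by `π ^ e_j` reduces to relations
among the `m_j`, and each such relation over `U` becomes one over `B` after multiplication by a
power of `π`. -/
theorem mem_span_relations_of_sum_pow_smul_eq_zero [IsScalarTower R U M]
    {K : Type*} [Field K] [Algebra R K]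
    [Algebra K A] [IsScalarTower R K A] {π : R} (hπ : algebraMap R K π ≠ 0)
    {B : Subalgebra R U} (hB : ∀ u : U, ∃ k : ℕ, ∀ l ≥ k, π ^ l • u ∈ B)
    {r : ℕ} {m : Fin r → M}
    (hm : ∀ x : M, ∃ u : Fin r → U, x = ∑ j, u j • m j) (e : Fin r → ℕ) {a : Fin r → A}
    (ha : ∑ j, a j • toBaseChange f M (π ^ e j • m j) = 0) :
    a ∈ Submodule.span A {w : Fin r → A | ∃ u : Fin r → B, ∑ j, (u j : U) • π ^ e j • m j = 0 ∧
      w = fun j ↦ f (u j)} := by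
  set Q := Submodule.span A {w : Fin r → A | ∃ u : Fin r → B,
    ∑ j, (u j : U) • π ^ e j • m j = 0 ∧ w = fun j ↦ f (u j)}
  have hK (k : ℕ) (x : A) : (algebraMap R K (π ^ k))⁻¹ • π ^ k • x = x := by
    rw [← algebraMap_smul K (π ^ k) x, smul_smul, inv_mul_cancel₀, one_smul]
    rw [map_pow]
    exact pow_ne_zero _ hπ
  let T : (Fin r → A) →ₗ[A] (Fin r → A) :=
    { toFun := fun w j ↦ π ^ e j • w j
      map_add' := fun v w ↦ by ext; simp
      map_smul' := fun c w ↦ by ext; simp }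
  have hT (w j) : T w j = π ^ e j • w j := rfl
  have hTinj : Function.Injective T := by
    intro v w h
    ext j
    rw [← hK (e j) (v j), ← hT, h, hT, hK]
  have h1 := mem_span_relations_of_sum_eq_zero f hm (a := T a) (by
    rw [← ha]
    refine Finset.sum_congr rfl fun j _ ↦ ?_
    rw [hT, map_smul, smul_assoc, smul_comm])
  have h2 : Submodule.span A {w : Fin r → A | ∃ u : Fin r → U, ∑ j, u j • m j = 0 ∧
      w = fun j ↦ f (u j)} ≤ Q.map T := by
    rw [Submodule.span_le]
    rintro _ ⟨u, hu, rfl⟩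
    choose k hk using fun j ↦ hB (u j)
    -- A common exponent large enough that `π ^ (N - e_j) u_j` lies in `B` for every `j`.
    let N := ∑ j, (k j + e j)
    have hN (j : Fin r) : k j + e j ≤ N :=
      Finset.single_le_sum (f := fun j ↦ k j + e j) (fun _ _ ↦ Nat.zero_le _) (Finset.mem_univ j)
    let v (j : Fin r) : B := ⟨π ^ (N - e j) • u j, hk j _ (by have := hN j; omega)⟩
    have hv (j : Fin r) : π ^ e j • (v j : U) = π ^ N • u j := by
      change π ^ e j • π ^ (N - e j) • u j = _
      rw [smul_smul, ← pow_add, Nat.add_sub_cancel' ((Nat.le_add_left _ _).trans (hN j))]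
    refine ⟨(algebraMap R K (π ^ N))⁻¹ • fun j ↦ f (v j), ?_, ?_⟩
    · refine Submodule.smul_of_tower_mem _ _ (Submodule.subset_span ⟨v, ?_, rfl⟩)
      have : ∑ j, (v j : U) • π ^ e j • m j = π ^ N • ∑ j, u j • m j := by
        rw [Finset.smul_sum]
        refine Finset.sum_congr rfl fun j _ ↦ ?_
        rw [smul_comm, ← smul_assoc, hv, smul_assoc]
      rw [this, hu, smul_zero]
    · ext j
      rw [hT, Pi.smul_apply, smul_comm, ← map_smul, hv, map_smul, hK]
  obtain ⟨b, hb, hab⟩ := h2 h1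
  rwa [← hTinj hab]

end BaseChangeLemmas

/-! ### Finitely generated submodules of free modules over the completion. -/

noncomputable section CompletionLemmas

variable {R : Type*} [CommRing R] {π : R} {B : Type*} [Ring B] [Algebra R B]

/-- The first level of the completion is `B / π B`, so divisibility of `b` by `π` can be read off
there. -/
theorem exists_eq_smul_of_toPiCompletion_eq_smul {b : B} {y : piCompletion π B}
    (h : toPiCompletion π B b = π • y) : ∃ z : B, b = π • z := by
  obtain ⟨u, hu⟩ := Ideal.Quotient.mk_surjective (y.1 1)
  have h1 : Ideal.Quotient.mk (scalarIdeal (π ^ 1) B) b = π • y.1 1 :=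
    congrFun (congrArg Subtype.val h) 1
  rw [← hu] at h1
  have h2 : Ideal.Quotient.mk (scalarIdeal (π ^ 1) B) b = Ideal.Quotient.mk _ (π • u) := h1
  rw [Ideal.Quotient.mk_eq_mk_iff_sub_mem, mem_scalarIdeal, pow_one] at h2
  obtain ⟨v, hv⟩ := h2
  exact ⟨v + u, by rw [smul_add, ← hv, sub_add_cancel]⟩

theorem pow_smul_piCompletion_apply_eq_zero {i k : ℕ} (h : k ≤ i) (x : piCompletion π B) :
    (π ^ i • x).1 k = 0 := by
  obtain ⟨u, hu⟩ := Ideal.Quotient.mk_surjective (x.1 k)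
  change π ^ i • x.1 k = 0
  rw [← hu]
  change Ideal.Quotient.mk (scalarIdeal (π ^ k) B) (π ^ i • u) = 0
  rw [Ideal.Quotient.eq_zero_iff_mem]
  exact scalarIdeal_pow_le π B h (mem_scalarIdeal.2 ⟨u, rfl⟩)

theorem sum_pow_smul_piCompletion_apply (d : ℕ → piCompletion π B) {i k : ℕ} (h : i ≤ k) :
    (∑ l ∈ Finset.range k, π ^ l • d l).1 i = (∑ l ∈ Finset.range i, π ^ l • d l).1 i := by
  induction k, h using Nat.le_induction with
  | base => rfl
  | succ k hk ih =>
    rw [Finset.sum_range_succ]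
    change _ + (π ^ k • d k).1 i = _
    rw [pow_smul_piCompletion_apply_eq_zero hk, add_zero]
    exact ih

/-- At level `k` all terms from the `k`-th on vanish, so the partial sums stabilise at each level
and define the sum of the series. -/
theorem exists_piCompletion_sum (d : ℕ → piCompletion π B) :
    ∃ e : piCompletion π B, ∀ k, e.1 k = (∑ l ∈ Finset.range k, π ^ l • d l).1 k := by
  refine ⟨⟨fun k ↦ (∑ l ∈ Finset.range k, π ^ l • d l).1 k, fun i j h ↦ ?_⟩, fun k ↦ rfl⟩
  rw [(∑ l ∈ Finset.range j, π ^ l • d l).2 i j h]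
  exact sum_pow_smul_piCompletion_apply d h

variable {r s : ℕ} (g : Fin s → Fin r → B)

/-- The submodule of `(B^) ^ r` generated by a finite family of elements of `B ^ r`. -/
def completedSpan (π : R) : Submodule (piCompletion π B) (Fin r → piCompletion π B) :=
  Submodule.span _ (Set.range fun l j ↦ toPiCompletion π B (g l j))

variable {g}

theorem mem_completedSpan_iff {x : Fin r → piCompletion π B} : x ∈ completedSpan g π ↔
    ∃ d : Fin s → piCompletion π B, x = fun j ↦ ∑ l, d l * toPiCompletion π B (g l j) := by
  rw [completedSpan, Submodule.mem_span_range_iff_exists_fun]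
  refine exists_congr fun d ↦ ?_
  rw [eq_comm]
  refine Eq.congr_right ?_
  ext1 j
  simp

theorem toPiCompletion_mem_completedSpan {z : Fin r → B}
    (hz : z ∈ Submodule.span B (Set.range g)) :
    (fun j ↦ toPiCompletion π B (z j)) ∈ completedSpan g π := by
  obtain ⟨c, rfl⟩ := (Submodule.mem_span_range_iff_exists_fun B).1 hz
  refine mem_completedSpan_iff.2 ⟨fun l ↦ toPiCompletion π B (c l), ?_⟩
  ext1 j
  simp

/-- An element of the completed span is congruent modulo `π` to an element of the span. -/
theorem exists_of_mem_completedSpan (hB : ∀ b : B, π • b = 0 → b = 0)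
    {x : Fin r → piCompletion π B} (hx : x ∈ completedSpan g π) :
    ∃ z ∈ Submodule.span B (Set.range g), ∃ y ∈ completedSpan g π,
      x = (fun j ↦ toPiCompletion π B (z j)) + π • y := by
  obtain ⟨d, rfl⟩ := mem_completedSpan_iff.1 hx
  choose δ y hδ using fun l ↦ piCompletion_approx hB (d l)
  refine ⟨∑ l, δ l • g l, Submodule.sum_mem _ fun l _ ↦ Submodule.smul_mem _ _
    (Submodule.subset_span ⟨l, rfl⟩), _, mem_completedSpan_iff.2 ⟨y, rfl⟩, ?_⟩
  ext1 j
  simp only [hδ, add_mul, Finset.sum_add_distrib, Pi.add_apply, Pi.smul_apply, Finset.sum_apply,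
    smul_eq_mul, map_sum, map_mul, Finset.smul_sum, smul_mul_assoc]

/-- Modulo `π` the completed span is no larger than the span itself, and `B / π B` embeds in the
completion modulo `π`. -/
theorem exists_of_toPiCompletion_sub_mem_completedSpan (hB : ∀ b : B, π • b = 0 → b = 0)
    {u : Fin r → B} {y : Fin r → piCompletion π B}
    (h : (fun j ↦ toPiCompletion π B (u j)) - π • y ∈ completedSpan g π) :
    ∃ z ∈ Submodule.span B (Set.range g), ∃ v : Fin r → B, u = z + π • v := by
  obtain ⟨z, hz, y', -, h'⟩ := exists_of_mem_completedSpan hB h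
  have key (j : Fin r) : ∃ w : B, u j - z j = π • w := by
    refine exists_eq_smul_of_toPiCompletion_eq_smul (y := y j + y' j) ?_
    have := congrFun h' j
    simp only [Pi.sub_apply, Pi.add_apply, Pi.smul_apply] at this
    rw [sub_eq_iff_eq_add] at this
    rw [map_sub, this, smul_add]
    abel
  choose v hv using key
  refine ⟨z, hz, v, ?_⟩
  ext1 j
  rw [Pi.add_apply, Pi.smul_apply, ← hv, add_sub_cancel]

/-- Write `π x = z + π y` with `z` in the span over `B` and `y` in the completed span. Then `z = π
w` with `w` in the span by saturation, and cancelling `π` gives `x = w + y`. -/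
theorem mem_completedSpan_of_smul_mem (hB : ∀ b : B, π • b = 0 → b = 0)
    (hsat : ∀ z : Fin r → B, π • z ∈ Submodule.span B (Set.range g) →
      z ∈ Submodule.span B (Set.range g))
    {x : Fin r → piCompletion π B} (hx : π • x ∈ completedSpan g π) : x ∈ completedSpan g π := by
  obtain ⟨z, hz, y, hy, h⟩ := exists_of_mem_completedSpan hB hx
  have key (j : Fin r) : ∃ w : B, z j = π • w := by
    refine exists_eq_smul_of_toPiCompletion_eq_smul (y := x j - y j) ?_
    have := congrFun h j
    simp only [Pi.add_apply, Pi.smul_apply] at this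
    rw [smul_sub, this, add_sub_cancel_right]
  choose w hw using key
  obtain rfl : z = π • w := by ext1 j; exact hw j
  have h2 : x = (fun j ↦ toPiCompletion π B (w j)) + y := by
    ext1 j
    rw [← sub_eq_zero]
    refine piCompletion_torsionFree hB _ ?_
    have := congrFun h j
    simp only [Pi.add_apply, Pi.smul_apply, map_smul] at this
    rw [Pi.add_apply, smul_sub, smul_add, this, sub_self]
  rw [h2]
  exact add_mem (toPiCompletion_mem_completedSpan (hsat w hz)) hy

theorem mem_completedSpan_of_pow_smul_mem (hB : ∀ b : B, π • b = 0 → b = 0)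
    (hsat : ∀ z : Fin r → B, π • z ∈ Submodule.span B (Set.range g) →
      z ∈ Submodule.span B (Set.range g))
    {x : Fin r → piCompletion π B} {N : ℕ} (hx : π ^ N • x ∈ completedSpan g π) :
    x ∈ completedSpan g π := by
  induction N with
  | zero => rwa [pow_zero, one_smul] at hx
  | succ N ih =>
    rw [pow_succ', mul_smul] at hx
    exact ih (mem_completedSpan_of_smul_mem hB hsat hx)

/-- The completed span of a saturated finitely generated submodule is `π`-adically closed. -/
theorem mem_completedSpan_of_forall (hB : ∀ b : B, π • b = 0 → b = 0)
    (hsat : ∀ z : Fin r → B, π • z ∈ Submodule.span B (Set.range g) →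
      z ∈ Submodule.span B (Set.range g))
    {x : Fin r → piCompletion π B} (hx : ∀ i : ℕ, ∃ y, x - π ^ i • y ∈ completedSpan g π) :
    x ∈ completedSpan g π := by
  -- `C` is the `π`-adic closure of the completed span. Saturation makes the remainder of a
  -- first-order approximation again an element of `C`, so approximation can be iterated.
  let C := {x : Fin r → piCompletion π B // ∀ i : ℕ, ∃ y, x - π ^ i • y ∈ completedSpan g π}
  have step (x : C) : ∃ (d : Fin s → piCompletion π B) (x' : C),
      x.1 = (fun j ↦ ∑ l, d l * toPiCompletion π B (g l j)) + π • x'.1 := by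
    obtain ⟨y, hy⟩ := x.2 1
    rw [pow_one] at hy
    obtain ⟨d, hd⟩ := mem_completedSpan_iff.1 hy
    refine ⟨d, ⟨y, fun i ↦ ?_⟩, ?_⟩
    · obtain ⟨z, hz⟩ := x.2 (i + 1)
      refine ⟨z, mem_completedSpan_of_smul_mem hB hsat ?_⟩
      have h1 := sub_mem hz hy
      rw [sub_sub_sub_cancel_left, pow_succ', mul_smul] at h1
      have h2 : π • (y - π ^ i • z) = π • y - π • π ^ i • z := by
        ext1 j
        exact smul_sub π (y j) (π ^ i • z j)
      rwa [h2]
    · rw [← hd, sub_add_cancel]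
  choose d x' hx' using step
  let a : ℕ → C := fun i ↦ x'^[i] ⟨x, hx⟩
  have ha (i : ℕ) : a (i + 1) = x' (a i) := Function.iterate_succ_apply' _ _ _
  have hsum (k : ℕ) (j : Fin r) : x j = ∑ l, (∑ i ∈ Finset.range k, π ^ i • d (a i) l) *
      toPiCompletion π B (g l j) + π ^ k • (a k).1 j := by
    induction k with
    | zero => simp [a]
    | succ k ih =>
      rw [ih, hx' (a k), ← ha]
      simp only [Finset.sum_range_succ, add_mul, Finset.sum_add_distrib, Pi.add_apply,
        Pi.smul_apply, smul_add, Finset.smul_sum, smul_mul_assoc, pow_succ, mul_smul, add_assoc]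
  -- As the generators `g l` are finitely many and fixed, only their coefficients vary, and each
  -- coefficient series converges in the completion.
  choose e he using fun l ↦ exists_piCompletion_sum fun i ↦ d (a i) l
  refine mem_completedSpan_iff.2 ⟨e, ?_⟩
  ext j k
  have h1 : (x j).1 k = (∑ l, (∑ i ∈ Finset.range k, π ^ i • d (a i) l) *
      toPiCompletion π B (g l j)).1 k + (π ^ k • (a k).1 j).1 k :=
    congrFun (congrArg Subtype.val (hsum k j)) k
  rw [pow_smul_piCompletion_apply_eq_zero le_rfl, add_zero] at h1
  have hev (y : Fin s → piCompletion π B) : (∑ l, y l * toPiCompletion π B (g l j)).1 k =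
      ∑ l, (y l).1 k * (toPiCompletion π B (g l j)).1 k := by
    rw [AddSubmonoidClass.coe_finsetSum, Finset.sum_apply]
    rfl
  refine h1.trans ?_
  refine (hev _).trans (Eq.trans ?_ (hev _).symm)
  refine Finset.sum_congr rfl fun l _ ↦ ?_
  rw [he]

end CompletionLemmas

/-! ### The lattice generated by `M_n` in the completed base change. -/

noncomputable section InducedLattice

variable {R : Type*} [CommRing R] {π : R} {U : Type*} [Ring U] [Algebra R U]
  {F : ℤ → Submodule R U} [IsRingFiltration F (fun i ↦ F (i - 1))]
  {M : Type*} [AddCommGroup M] [Module R M] [Module U M]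
  {G : ℤ → Submodule R M} {n r : ℕ} {m : Fin r → M} {e : Fin r → ℕ}

theorem smul_mem_deformationFilt [IsScalarTower R U M]
    [IsModuleFiltration F (fun i ↦ F (i - 1)) G (fun i ↦ G (i - 1))] {i j : ℤ} {u : U} {x : M}
    (hu : u ∈ deformationFilt π F n i) (hx : x ∈ deformationFilt π G n j) :
    u • x ∈ deformationFilt π G n (i + j) := by
  suffices h : Submodule.map₂ (Algebra.lsmul R R M : U →ₐ[R] M →ₗ[R] M).toLinearMap
      (deformationFilt π F n i) (deformationFilt π G n j) ≤ deformationFilt π G n (i + j) from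
    h (Submodule.apply_mem_map₂ _ hu hx)
  conv_lhs => rw [deformationFilt, deformationFilt]
  simp only [Submodule.map₂_iSup_left, Submodule.map₂_iSup_right, iSup_le_iff]
  intro k hk l hl
  rw [Submodule.map₂_le]
  rintro _ ⟨a, ha, rfl⟩ _ ⟨b, hb, rfl⟩
  change (π ^ (l * n) • a) • π ^ (k * n) • b ∈ deformationFilt π G n (i + j)
  refine deformationFilt_mono π G n (show ((l + k : ℕ) : ℤ) ≤ i + j by push_cast; omega) ?_
  rw [smul_smul_smul_comm, smul_eq_mul, ← pow_add, ← add_mul]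
  refine pow_smul_mem_deformationFilt ?_
  push_cast
  exact smul_mem_filtration F G ha hb

theorem smul_mem_deformation [IsScalarTower R U M]
    [IsModuleFiltration F (fun i ↦ F (i - 1)) G (fun i ↦ G (i - 1))] {u : U} {x : M}
    (hu : u ∈ deformation π F n) (hx : x ∈ deformation π G n) : u • x ∈ deformation π G n := by
  obtain ⟨i, hi⟩ := exists_mem_deformationFilt π F n hu
  obtain ⟨j, hj⟩ := exists_mem_deformationFilt π G n hx
  exact deformationFilt_le π G n _ (smul_mem_deformationFilt hi hj)

variable (π F G n m e) in
/-- The `m_j` generate `M`, the `π ^ e_j m_j` generate the deformation `M_n`, and `M_n` contains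
high multiples of the elements of `M`. -/
structure GeneratesDeformation : Prop where
  exists_sum : ∀ x : M, ∃ u : Fin r → U, x = ∑ j, u j • m j
  mem : ∀ j, π ^ e j • m j ∈ deformation π G n
  exists_sum_deformation : ∀ x ∈ deformation π G n,
    ∃ u : Fin r → deformedAlg π F n, x = ∑ j, (u j : U) • π ^ e j • m j
  smul_mem : ∀ u ∈ deformation π F n, ∀ x ∈ deformation π G n, u • x ∈ deformation π G n
  exists_pow_smul_mem : ∀ x : M, ∃ k : ℕ, ∀ l ≥ k, π ^ l • x ∈ deformation π G n

theorem IsGoodFiltration.exists_generatesDeformation [IsScalarTower R U M] (hF : IsDeformable F)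
    (h : IsGoodFiltration F G) :
    ∃ (r : ℕ) (m : Fin r → M) (e : Fin r → ℕ), GeneratesDeformation π F G n m e := by
  obtain ⟨r, k, m, hG⟩ := h.exists_generators
  have := h.isModuleFiltration
  -- The weight of `m_j` in `M_n` is its degree `k_j` times `n`; truncating at zero is harmless
  -- because `m_j = 0` when `k_j < 0`.
  exact ⟨r, m, fun j ↦ (k j).toNat * n, h.span_generators hG, h.pow_smul_generator_mem hG n,
    fun x hx ↦ h.exists_of_mem_deformation hF hG hx,
    fun u hu x hx ↦ smul_mem_deformation hu hx,
    exists_pow_smul_mem_deformation h.monotone h.exhaustive⟩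

variable [IsDomain R] [IsDiscreteValuationRing R] (K : Type*) [Field K] [Algebra R K]
  [IsFractionRing R K]

section Algebra

theorem exists_pow_smul_eq_algebraMap (hπ : Irreducible π) (q : K) :
    ∃ (k : ℕ) (a : R), π ^ k • q = algebraMap R K a := by
  obtain ⟨a, s, rfl⟩ := IsLocalization.exists_mk'_eq (nonZeroDivisors R) q
  obtain ⟨k, u, hu⟩ := IsDiscreteValuationRing.eq_unit_mul_pow_irreducible
    (nonZeroDivisors.ne_zero s.2) hπ
  refine ⟨k, (u⁻¹ : Rˣ) * a, ?_⟩
  have h1 : π ^ k = (u⁻¹ : Rˣ) * s := by rw [hu, Units.inv_mul_cancel_left]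
  rw [h1, mul_smul, Algebra.smul_def (s : R), IsLocalization.mk'_spec', Algebra.smul_def, map_mul]

theorem exists_pow_smul_eq_completionToCompletedAlg (hπ : Irreducible π) {B : Type*} [Ring B]
    [Algebra R B] (a : CompletedAlg π K B) :
    ∃ (k : ℕ) (x : piCompletion π B), π ^ k • a = completionToCompletedAlg π K B x := by
  change K ⊗[R] piCompletion π B at a
  induction a with
  | zero => exact ⟨0, 0, by rw [map_zero]; exact smul_zero (A := CompletedAlg π K B) _⟩
  | tmul q x =>
    obtain ⟨k, b, hb⟩ := exists_pow_smul_eq_algebraMap K hπ q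
    refine ⟨k, b • x, ?_⟩
    change π ^ k • (q ⊗ₜ[R] x) = (1 : K) ⊗ₜ[R] (b • x)
    rw [TensorProduct.smul_tmul', hb, ← TensorProduct.smul_tmul, Algebra.smul_def, mul_one]
  | add a b ha hb =>
    obtain ⟨k, x, hx⟩ := ha
    obtain ⟨l, y, hy⟩ := hb
    refine ⟨k + l, π ^ l • x + π ^ k • y, ?_⟩
    rw [map_add, map_smul, map_smul, ← hx, ← hy]
    change π ^ (k + l) • (a + b) = π ^ l • π ^ k • a + π ^ k • π ^ l • b
    rw [smul_add, smul_smul, smul_smul, ← pow_add, ← pow_add, add_comm l k]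

variable (hF : IsDeformable F) (hπ : Irreducible π)

omit [IsDiscreteValuationRing R] in
-- For `u ∈ U_n` the preimage of `1 ⊗ u` under `K ⊗ U_n ≃ K ⊗ U` is again `1 ⊗ u`, so no
-- denominators appear.
theorem toCompletedDeformation_of_mem {u : U} (hu : u ∈ deformedAlg π F n) :
    toCompletedDeformation K hF hπ n u =
      completionToCompletedAlg π K _ (toPiCompletion π _ ⟨u, hu⟩) := by
  have h : (AlgEquiv.ofBijective _ (deformedAlg_tensor_bijective K hF hπ n)).symm
      ((1 : K) ⊗ₜ[R] u) = (1 : K) ⊗ₜ[R] (⟨u, hu⟩ : deformedAlg π F n) := by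
    rw [AlgEquiv.symm_apply_eq]
    rfl
  have h2 : toCompletedDeformation K hF hπ n u =
      (Algebra.TensorProduct.map (AlgHom.id R K) (toPiCompletion π (deformedAlg π F n)))
      ((AlgEquiv.ofBijective _ (deformedAlg_tensor_bijective K hF hπ n)).symm
        ((1 : K) ⊗ₜ[R] u)) := rfl
  rw [h2, h]
  rfl

variable (n) in
/-- The map from `U_n` to the slice of `(U_n)^ ⊗ K`. -/
def deformedAlgToSlice : deformation π F n →ₗ[R] (deformedDoublyFiltered K hF hπ n).F₀ ⧸
    scalarIdeal π (deformedDoublyFiltered K hF hπ n).F₀ :=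
  (toCompletedSlice π K (deformedAlg π F n)).toLinearMap ∘ₗ deformationToAlg π F n

theorem deformedAlg_isDeformationImage (n : ℕ) :
    IsDeformationImage π F n (deformedAlgToSlice n K hF hπ)
      (deformedDoublyFiltered K hF hπ n).filt :=
  hF.isDeformationImage _

/-- Together with surjectivity this identifies the slice of the completed algebra with `B / π B`. -/
theorem toCompletedSlice_eq_zero_iff {B : Type*} [Ring B] [Algebra R B] (hπ : Irreducible π)
    (hB : ∀ b : B, π • b = 0 → b = 0) (b : B) :
    toCompletedSlice π K B b = 0 ↔ ∃ y, b = π • y := by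
  let z (b : B) : completedF₀ π K B :=
    ⟨completionToCompletedAlg π K B (toPiCompletion π B b), _, rfl⟩
  have h : toCompletedSlice π K B b = Ideal.Quotient.mk (scalarIdeal π (completedF₀ π K B)) (z b) :=
    rfl
  rw [h, Ideal.Quotient.eq_zero_iff_mem, mem_scalarIdeal]
  constructor
  · rintro ⟨⟨_, y, rfl⟩, hy⟩
    refine exists_eq_smul_of_toPiCompletion_eq_smul (y := y)
      (completionToCompletedAlg_injective π K hπ hB ?_)
    rw [map_smul]
    exact congrArg Subtype.val hy
  · rintro ⟨y, rfl⟩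
    refine ⟨z y, Subtype.ext ?_⟩
    change completionToCompletedAlg π K B (toPiCompletion π B (π • y)) =
      π • completionToCompletedAlg π K B (toPiCompletion π B y)
    rw [map_smul, map_smul]

end Algebra

section Lattice

variable (hF : IsDeformable F) (hπ : Irreducible π)

variable (G n) in
/-- The `(U_n)^`-submodule of `(U_n)^ ⊗ K ⊗_U M` generated by the elements `1 ⊗ m`, `m ∈ M_n`. -/
def inducedLattice : Submodule (deformedDoublyFiltered K hF hπ n).F₀
    (BaseChange (toCompletedDeformation K hF hπ n) M) :=
  Submodule.span _ (toBaseChange (toCompletedDeformation K hF hπ n) M '' deformation π G n)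

theorem toBaseChange_mem_inducedLattice {x : M} (hx : x ∈ deformation π G n) :
    toBaseChange (toCompletedDeformation K hF hπ n) M x ∈ inducedLattice G n K hF hπ :=
  Submodule.subset_span ⟨x, hx, rfl⟩

theorem completion_smul_mem_inducedLattice (b : piCompletion π (deformedAlg π F n))
    {v : BaseChange (toCompletedDeformation K hF hπ n) M}
    (hv : v ∈ inducedLattice G n K hF hπ) :
    completionToCompletedAlg π K _ b • v ∈ inducedLattice G n K hF hπ :=
  (inducedLattice G n K hF hπ).smul_mem
    (⟨_, b, rfl⟩ : (deformedDoublyFiltered K hF hπ n).F₀) hv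

omit [IsDiscreteValuationRing R] in
theorem completion_smul_toBaseChange (u : deformedAlg π F n) (x : M) :
    completionToCompletedAlg π K _ (toPiCompletion π _ u) •
      toBaseChange (toCompletedDeformation K hF hπ n) M x =
        toBaseChange (toCompletedDeformation K hF hπ n) M ((u : U) • x) := by
  rw [toBaseChange_smul, toCompletedDeformation_of_mem K hF hπ u.2]

/-- Finitely many `π ^ e_j m_j` generate `M_n` over `U_n`, so their images generate the lattice over
the completion. Lattice elements thus acquire coordinates in a free module of finite rank, where
convergence arguments apply. -/
theorem exists_of_mem_inducedLattice [IsScalarTower R U M]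
    (hm : GeneratesDeformation π F G n m e)
    {v : BaseChange (toCompletedDeformation K hF hπ n) M}
    (hv : v ∈ inducedLattice G n K hF hπ) :
    ∃ b : Fin r → piCompletion π (deformedAlg π F n),
      v = ∑ j, completionToCompletedAlg π K _ (b j) •
        toBaseChange (toCompletedDeformation K hF hπ n) M (π ^ e j • m j) := by
  induction hv using Submodule.span_induction with
  | mem v hv =>
    obtain ⟨x, hx, rfl⟩ := hv
    obtain ⟨u, rfl⟩ := hm.exists_sum_deformation x hx
    refine ⟨fun j ↦ toPiCompletion π _ (u j), ?_⟩
    rw [map_sum]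
    exact Finset.sum_congr rfl fun j _ ↦ (completion_smul_toBaseChange K hF hπ _ _).symm
  | zero => exact ⟨0, by simp⟩
  | add v w _ _ hv hw =>
    obtain ⟨b, rfl⟩ := hv
    obtain ⟨c, rfl⟩ := hw
    exact ⟨b + c, by simp only [Pi.add_apply, map_add, add_smul, Finset.sum_add_distrib]⟩
  | smul a v _ hv =>
    obtain ⟨_, c, rfl⟩ := a
    obtain ⟨b, rfl⟩ := hv
    refine ⟨fun j ↦ c * b j, ?_⟩
    simp only [map_mul, mul_smul]
    exact Finset.smul_sum (r := completionToCompletedAlg π K _ c)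

/-- Approximating each coordinate modulo `π` by an element of `U_n` suffices; this gives
surjectivity of `M_n` onto the slice. -/
theorem exists_approx_of_mem_inducedLattice [IsScalarTower R U M]
    (hm : GeneratesDeformation π F G n m e)
    {v : BaseChange (toCompletedDeformation K hF hπ n) M}
    (hv : v ∈ inducedLattice G n K hF hπ) :
    ∃ x ∈ deformation π G n, ∃ w ∈ inducedLattice G n K hF hπ,
      v = toBaseChange (toCompletedDeformation K hF hπ n) M x + π • w := by
  obtain ⟨b, rfl⟩ := exists_of_mem_inducedLattice K hF hπ hm hv
  choose u y hb using fun j ↦ piCompletion_approx (hF.deformedAlg_torsionFree n hπ) (b j)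
  have hmem (j : Fin r) : (u j : U) • π ^ e j • m j ∈ deformation π G n :=
    hm.smul_mem _ (u j).2 _ (hm.mem j)
  refine ⟨∑ j, (u j : U) • π ^ e j • m j, Submodule.sum_mem _ fun j _ ↦ hmem j,
    ∑ j, completionToCompletedAlg π K _ (y j) •
      toBaseChange (toCompletedDeformation K hF hπ n) M (π ^ e j • m j),
    Submodule.sum_mem _ fun j _ ↦
    completion_smul_mem_inducedLattice K hF hπ (y j)
      (toBaseChange_mem_inducedLattice K hF hπ (hm.mem j)), ?_⟩
  rw [map_sum, Finset.smul_sum, ← Finset.sum_add_distrib]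
  refine Finset.sum_congr rfl fun j _ ↦ ?_
  rw [hb, map_add, map_smul, add_smul, completion_smul_toBaseChange, smul_assoc]

variable (π F n m e) in
/-- The relations over `U_n` between the elements `π ^ e_j m_j`. -/
def deformationRelations : Submodule (deformedAlg π F n) (Fin r → deformedAlg π F n) where
  carrier := {u | ∑ j, (u j : U) • π ^ e j • m j = 0}
  add_mem' {u v} hu hv := by
    rw [Set.mem_ofPred_eq] at *
    simp only [Pi.add_apply, AddMemClass.coe_add, add_smul, Finset.sum_add_distrib, hu, hv,
      add_zero]
  zero_mem' := by simp
  smul_mem' c u hu := by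
    rw [Set.mem_ofPred_eq] at *
    simp only [Pi.smul_apply, smul_eq_mul, MulMemClass.coe_mul, mul_smul]
    rw [← Finset.smul_sum, hu, smul_zero]

omit [IsDomain R] [IsDiscreteValuationRing R] in
theorem mem_deformationRelations {u : Fin r → deformedAlg π F n} :
    u ∈ deformationRelations π F n m e ↔ ∑ j, (u j : U) • π ^ e j • m j = 0 := Iff.rfl

omit [IsDomain R] [IsDiscreteValuationRing R] in
-- Torsionfreeness of `M` says precisely that a relation may be divided by `π`. All arguments on the
-- completed span rest on this saturation.
theorem mem_deformationRelations_of_smul_mem [IsScalarTower R U M]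
    (hM : ∀ x : M, π • x = 0 → x = 0)
    {u : Fin r → deformedAlg π F n} (hu : π • u ∈ deformationRelations π F n m e) :
    u ∈ deformationRelations π F n m e := by
  rw [mem_deformationRelations] at *
  refine hM _ ?_
  rw [← hu, Finset.smul_sum]
  refine Finset.sum_congr rfl fun j _ ↦ ?_
  rw [Pi.smul_apply, Subalgebra.coe_smul, smul_assoc]

variable {s : ℕ} {g : Fin s → Fin r → deformedAlg π F n}
  (hg : Submodule.span _ (Set.range g) = deformationRelations π F n m e)
include hg

/-- The relations over the completion are generated by those over `U_n`. -/
theorem mem_completedSpan_of_sum_eq_zero [IsScalarTower R U M]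
    (hm : GeneratesDeformation π F G n m e) (hM : ∀ x : M, π • x = 0 → x = 0)
    {b : Fin r → piCompletion π (deformedAlg π F n)}
    (hb : ∑ j, completionToCompletedAlg π K _ (b j) •
      toBaseChange (toCompletedDeformation K hF hπ n) M (π ^ e j • m j) = 0) :
    b ∈ completedSpan g π := by
  have hinj := completionToCompletedAlg_injective π K hπ (hF.deformedAlg_torsionFree n hπ)
  have h1 := mem_span_relations_of_sum_pow_smul_eq_zero (K := K) (π := π)
    (toCompletedDeformation K hF hπ n)
    ((map_ne_zero_iff _ (IsFractionRing.injective R K)).2 hπ.ne_zero)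
    (B := deformedAlg π F n)
    (exists_pow_smul_mem_deformation filtration_monotone hF.exhaustive) hm.exists_sum e hb
  -- Clearing denominators in the coefficients: each relation over the `K`-algebra is carried by a
  -- power of `π` into the completed span, and saturation then removes that power.
  have h2 : ∀ w ∈ Submodule.span (CompletedAlg π K (deformedAlg π F n))
      {w : Fin r → CompletedAlg π K (deformedAlg π F n) | ∃ u : Fin r → deformedAlg π F n,
        ∑ j, (u j : U) • π ^ e j • m j = 0 ∧
          w = fun j ↦ toCompletedDeformation K hF hπ n (u j)},
      ∃ (N : ℕ) (x : Fin r → piCompletion π (deformedAlg π F n)), x ∈ completedSpan g π ∧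
        ∀ j, π ^ N • w j = completionToCompletedAlg π K _ (x j) := by
    intro w hw
    induction hw using Submodule.span_induction with
    | mem w hw =>
      obtain ⟨u, hu, rfl⟩ := hw
      refine ⟨0, _, toPiCompletion_mem_completedSpan (z := u) ?_, fun j ↦ ?_⟩
      · rw [hg]
        exact hu
      · rw [pow_zero, one_smul]
        exact toCompletedDeformation_of_mem K hF hπ (u j).2
    | zero => exact ⟨0, 0, zero_mem _, by simp⟩
    | add v w _ _ hv hw =>
      obtain ⟨N, x, hx, hv⟩ := hv
      obtain ⟨N', x', hx', hw⟩ := hw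
      refine ⟨N + N', π ^ N' • x + π ^ N • x', add_mem ?_ ?_, fun j ↦ ?_⟩
      · exact Submodule.smul_of_tower_mem _ _ hx
      · exact Submodule.smul_of_tower_mem _ _ hx'
      · rw [Pi.add_apply, Pi.add_apply, Pi.smul_apply, Pi.smul_apply, map_add, map_smul, map_smul,
          ← hv, ← hw, smul_smul, smul_smul, ← pow_add, ← pow_add, add_comm N' N, smul_add]
    | smul a w _ hw =>
      obtain ⟨N, x, hx, hw⟩ := hw
      obtain ⟨k, y, hy⟩ := exists_pow_smul_eq_completionToCompletedAlg K hπ a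
      refine ⟨k + N, fun j ↦ y * x j, (completedSpan g π).smul_mem y hx, fun j ↦ ?_⟩
      rw [Pi.smul_apply, smul_eq_mul, map_mul, ← hw, ← hy,
        smul_mul_smul_comm, pow_add]
  obtain ⟨N, x, hx, h⟩ := h2 _ h1
  refine mem_completedSpan_of_pow_smul_mem (N := N) (hF.deformedAlg_torsionFree n hπ) ?_ ?_
  · intro z hz
    rw [hg] at hz ⊢
    exact mem_deformationRelations_of_smul_mem hM hz
  · convert hx using 1
    ext1 j
    refine hinj ?_
    rw [← h, Pi.smul_apply, map_smul]

/-- This is injectivity of `M_n / π M_n → L / π L`. If `x` has coefficients `u` and `v` has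
coordinates `b`, then `u - π b` is a relation over the completion, so `u` is a relation over `U_n`
up to a multiple of `π`. -/
theorem mem_deformation_of_toBaseChange_eq_smul [IsScalarTower R U M]
    (hm : GeneratesDeformation π F G n m e) (hM : ∀ x : M, π • x = 0 → x = 0) {x : M}
    (hx : x ∈ deformation π G n) {v : BaseChange (toCompletedDeformation K hF hπ n) M}
    (hv : v ∈ inducedLattice G n K hF hπ)
    (h : toBaseChange (toCompletedDeformation K hF hπ n) M x = π • v) :
    ∃ y ∈ deformation π G n, x = π • y := by
  obtain ⟨b, rfl⟩ := exists_of_mem_inducedLattice K hF hπ hm hv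
  obtain ⟨u, rfl⟩ := hm.exists_sum_deformation x hx
  have h1 := mem_completedSpan_of_sum_eq_zero K hF hπ hg hm hM
    (b := (fun j ↦ toPiCompletion π _ (u j)) - π • b) (by
      rw [map_sum, Finset.smul_sum, ← sub_eq_zero, ← Finset.sum_sub_distrib] at h
      rw [← h]
      refine Finset.sum_congr rfl fun j _ ↦ ?_
      rw [Pi.sub_apply, Pi.smul_apply, map_sub, map_smul, sub_smul, completion_smul_toBaseChange,
        smul_assoc])
  obtain ⟨z, hz, v, rfl⟩ :=
    exists_of_toPiCompletion_sub_mem_completedSpan (hF.deformedAlg_torsionFree n hπ) h1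
  rw [hg, mem_deformationRelations] at hz
  refine ⟨∑ j, (v j : U) • π ^ e j • m j, Submodule.sum_mem _ fun j _ ↦
    hm.smul_mem _ (v j).2 _ (hm.mem j), ?_⟩
  simp only [Pi.add_apply, Pi.smul_apply, AddMemClass.coe_add, Subalgebra.coe_smul, add_smul,
    Finset.sum_add_distrib, hz, zero_add, Finset.smul_sum, smul_assoc]

/-- If `b` are coordinates of `v` and `v = π ^ i w`, then `b - π ^ i c` is a relation for
coordinates `c` of `w`. So `b` is in the closure of the completed span of relations, hence in the
span itself, and `v = 0`. -/
theorem inducedLattice_separated [IsScalarTower R U M]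
    (hm : GeneratesDeformation π F G n m e) (hM : ∀ x : M, π • x = 0 → x = 0)
    {v : BaseChange (toCompletedDeformation K hF hπ n) M}
    (hv : ∀ i : ℕ, ∃ w ∈ inducedLattice G n K hF hπ, v = π ^ i • w) : v = 0 := by
  have hsat (z : Fin r → deformedAlg π F n) (hz : π • z ∈ Submodule.span (deformedAlg π F n) (Set.range g)) :
      z ∈ Submodule.span (deformedAlg π F n) (Set.range g) := by
    rw [hg] at hz ⊢
    exact mem_deformationRelations_of_smul_mem hM hz
  obtain ⟨w, hw, h0⟩ := hv 0
  rw [pow_zero, one_smul] at h0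
  obtain ⟨b, hb⟩ := exists_of_mem_inducedLattice K hF hπ hm hw
  rw [← h0] at hb
  have h1 : b ∈ completedSpan g π := by
    refine mem_completedSpan_of_forall (hF.deformedAlg_torsionFree n hπ) hsat fun i ↦ ?_
    obtain ⟨w, hw, h⟩ := hv i
    obtain ⟨c, rfl⟩ := exists_of_mem_inducedLattice K hF hπ hm hw
    refine ⟨c, mem_completedSpan_of_sum_eq_zero K hF hπ hg hm hM ?_⟩
    rw [hb, Finset.smul_sum, ← sub_eq_zero, ← Finset.sum_sub_distrib] at h
    rw [← h]
    refine Finset.sum_congr rfl fun j _ ↦ ?_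
    rw [Pi.sub_apply, Pi.smul_apply, map_sub, map_smul, sub_smul, smul_assoc]
  obtain ⟨d, rfl⟩ := mem_completedSpan_iff.1 h1
  rw [hb]
  have h2 (l : Fin s) : ∑ j, completionToCompletedAlg π K _ (toPiCompletion π _ (g l j)) •
      toBaseChange (toCompletedDeformation K hF hπ n) M (π ^ e j • m j) = 0 := by
    have : g l ∈ deformationRelations π F n m e := hg ▸ Submodule.subset_span ⟨l, rfl⟩
    rw [mem_deformationRelations] at this
    simp only [completion_smul_toBaseChange]
    rw [← map_sum, this, map_zero]
  simp only [map_sum, map_mul, Finset.sum_smul, mul_smul]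
  rw [Finset.sum_comm]
  refine Finset.sum_eq_zero fun l _ ↦ ?_
  rw [← Finset.smul_sum, h2, smul_zero]

omit hg in
theorem span_inducedLattice (hm : GeneratesDeformation π F G n m e) :
    Submodule.span K ((inducedLattice G n K hF hπ :
      Set (BaseChange (toCompletedDeformation K hF hπ n) M))) = ⊤ := by
  have hK (k : ℕ) (x : BaseChange (toCompletedDeformation K hF hπ n) M) :
      (algebraMap R K (π ^ k))⁻¹ • π ^ k • x = x := by
    rw [← algebraMap_smul K (π ^ k) x, smul_smul, inv_mul_cancel₀, one_smul]
    rw [map_pow]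
    exact pow_ne_zero _ ((map_ne_zero_iff _ (IsFractionRing.injective R K)).2 hπ.ne_zero)
  rw [eq_top_iff]
  rintro v -
  have hv : v ∈ Submodule.span (CompletedAlg π K (deformedAlg π F n))
      (Set.range (toBaseChange (toCompletedDeformation K hF hπ n) M)) := by
    rw [span_range_toBaseChange]
    trivial
  induction hv using Submodule.closure_induction with
  | zero => exact Submodule.zero_mem _
  | add v w _ _ hv hw => exact Submodule.add_mem _ hv hw
  | smul_mem a v hv =>
    obtain ⟨x, rfl⟩ := hv
    obtain ⟨k, b, hb⟩ := exists_pow_smul_eq_completionToCompletedAlg K hπ a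
    obtain ⟨l, hl⟩ := hm.exists_pow_smul_mem x
    rw [← hK (k + l) (a • _)]
    refine Submodule.smul_mem _ _ (Submodule.subset_span ?_)
    rw [pow_add, mul_smul, ← smul_comm a (π ^ l), ← smul_assoc, hb, ← map_smul]
    exact completion_smul_mem_inducedLattice K hF hπ b
      (toBaseChange_mem_inducedLattice K hF hπ (hl l le_rfl))

theorem inducedLattice_isRLattice [IsScalarTower R U M]
    (hm : GeneratesDeformation π F G n m e) (hM : ∀ x : M, π • x = 0 → x = 0) :
    IsRLattice π K ((inducedLattice G n K hF hπ).restrictScalars R) := by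
  refine ⟨span_inducedLattice K hF hπ hm, ?_⟩
  rw [eq_bot_iff]
  intro v hv
  rw [Submodule.mem_iInf] at hv
  refine inducedLattice_separated K hF hπ hg hm hM fun i ↦ ?_
  obtain ⟨w, hw, rfl⟩ := (Submodule.mem_smul_pointwise_iff_exists _ _ _).1 (hv i)
  exact ⟨w, hw, rfl⟩

end Lattice

end InducedLattice

/-! ### The induced double filtration and its slice `M_n / π M_n`. -/

noncomputable section InducedDoubleFiltration

variable {R : Type*} [CommRing R] {π : R} {U : Type*} [Ring U] [Algebra R U]
  {F : ℤ → Submodule R U} [IsRingFiltration F (fun i ↦ F (i - 1))]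
  {M : Type*} [AddCommGroup M] [Module R M] [Module U M] [IsScalarTower R U M]
  {G : ℤ → Submodule R M} {n : ℕ} [IsDomain R] [IsDiscreteValuationRing R]
  (K : Type*) [Field K] [Algebra R K] [IsFractionRing R K]
  (hF : IsDeformable F) (hπ : Irreducible π)

omit [IsDomain R] [IsDiscreteValuationRing R] [Algebra R K] [IsFractionRing R K] in
theorem ModuleSlice.mk_eq_zero_iff {A : Type*} [Ring A] [Algebra R A] [Algebra K A]
    (𝓐 : DoublyFilteredAlgebra π K A) {V : Type*} [AddCommGroup V] [Module R V] [Module A V]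
    [IsScalarTower R A V] (L : Submodule 𝓐.F₀ V) (x : L) :
    ModuleSlice.mk 𝓐 L x = 0 ↔ ∃ y : L, (x : V) = π • (y : V) := by
  refine (Submodule.Quotient.mk_eq_zero (scalarIdeal π 𝓐.F₀ • (⊤ : Submodule 𝓐.F₀ L))).trans ?_
  constructor
  · intro hx
    induction hx using Submodule.smul_induction_on' with
    | smul a ha y _ =>
      obtain ⟨b, rfl⟩ := mem_scalarIdeal.1 ha
      exact ⟨b • y, smul_assoc π (b : A) (y : V)⟩
    | add x _ y _ hx hy =>
      obtain ⟨x', hx⟩ := hx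
      obtain ⟨y', hy⟩ := hy
      exact ⟨x' + y', by rw [Submodule.coe_add, Submodule.coe_add, smul_add, hx, hy]⟩
  · rintro ⟨y, hy⟩
    have : x = algebraMap R 𝓐.F₀ π • y :=
      Subtype.ext (hy.trans (algebraMap_smul A π (y : V)).symm)
    rw [this]
    exact Submodule.smul_mem_smul (Ideal.subset_span rfl) trivial

variable (G n) in
/-- The map from `M_n` to the slice of the induced lattice. -/
def deformationToSlice : deformation π G n →ₗ[R]
    ModuleSlice (deformedDoublyFiltered K hF hπ n) (inducedLattice G n K hF hπ) where
  toFun x := ModuleSlice.mk (deformedDoublyFiltered K hF hπ n) (inducedLattice G n K hF hπ)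
    ⟨_, toBaseChange_mem_inducedLattice K hF hπ x.2⟩
  map_add' x y := by
    rw [← map_add]
    congr 1
    ext
    exact map_add _ _ _
  map_smul' r x := by
    refine Eq.trans (congrArg _ ?_) (rfl :
      ModuleSlice.mk (deformedDoublyFiltered K hF hπ n) (inducedLattice G n K hF hπ)
        (r • ⟨_, toBaseChange_mem_inducedLattice K hF hπ x.2⟩) = _)
    ext
    exact map_smul _ _ _

omit [IsScalarTower R U M] in
theorem deformationToSlice_apply {x : M} (hx : x ∈ deformation π G n) :
    deformationToSlice G n K hF hπ ⟨x, hx⟩ =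
      ModuleSlice.mk (deformedDoublyFiltered K hF hπ n) (inducedLattice G n K hF hπ)
        ⟨_, toBaseChange_mem_inducedLattice K hF hπ hx⟩ := rfl

omit [IsScalarTower R U M] in
theorem deformationToSlice_smul {u : U} {x : M} (hu : u ∈ deformation π F n)
    (hx : x ∈ deformation π G n) (hux : u • x ∈ deformation π G n) :
    deformationToSlice G n K hF hπ ⟨u • x, hux⟩ =
      deformedAlgToSlice n K hF hπ ⟨u, hu⟩ •
        deformationToSlice G n K hF hπ ⟨x, hx⟩ := by
  rw [deformationToSlice_apply, deformationToSlice_apply]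
  refine congrArg (ModuleSlice.mk (deformedDoublyFiltered K hF hπ n) (inducedLattice G n K hF hπ)) (a₂ :=
    (⟨completionToCompletedAlg π K _ (toPiCompletion π _ ⟨u, hu⟩), _, rfl⟩ :
      (deformedDoublyFiltered K hF hπ n).F₀) •
    ⟨_, toBaseChange_mem_inducedLattice K hF hπ hx⟩) (Subtype.ext ?_)
  exact (completion_smul_toBaseChange K hF hπ ⟨u, hu⟩ x).symm

variable (hnoeth : IsNoetherianRing (Gr F)) (hM : ∀ x : M, π • x = 0 → x = 0)
  (hG : IsGoodFiltration F G)
include hnoeth hM hG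

/-- Noetherianity of `U_n` supplies finitely many generating relations. The chosen generators and
relations are confined to this proof, and only choice-free consequences leave it. -/
theorem inducedLattice_properties :
    IsRLattice π K ((inducedLattice G n K hF hπ).restrictScalars R) ∧
    (∀ x ∈ deformation π G n, ∀ v ∈ inducedLattice G n K hF hπ,
      toBaseChange (toCompletedDeformation K hF hπ n) M x = π • v →
        ∃ y ∈ deformation π G n, x = π • y) ∧
    ∀ v ∈ inducedLattice G n K hF hπ, ∃ x ∈ deformation π G n, ∃ w ∈ inducedLattice G n K hF hπ,
      v = toBaseChange (toCompletedDeformation K hF hπ n) M x + π • w := by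
  obtain ⟨r, m, e, hm⟩ := hG.exists_generatesDeformation (π := π) (n := n) hF
  have := hF.isNoetherianRing_deformedAlg (π := π) hnoeth n
  obtain ⟨s, g, hg⟩ := Submodule.fg_iff_exists_fin_generating_family.1
    (IsNoetherian.noetherian (deformationRelations π F n m e))
  exact ⟨inducedLattice_isRLattice K hF hπ hg hm hM,
    fun x hx v hv h ↦ mem_deformation_of_toBaseChange_eq_smul K hF hπ hg hm hM hx hv h,
    fun v hv ↦ exists_approx_of_mem_inducedLattice K hF hπ hm hv⟩

theorem deformationToSlice_eq_zero_iff (x : deformation π G n) :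
    deformationToSlice G n K hF hπ x = 0 ↔ ∃ y, x = π • y := by
  obtain ⟨x, hx⟩ := x
  rw [deformationToSlice_apply, ModuleSlice.mk_eq_zero_iff]
  constructor
  · rintro ⟨⟨v, hv⟩, h⟩
    obtain ⟨y, hy, rfl⟩ :=
      (inducedLattice_properties K hF hπ hnoeth hM hG).2.1 x hx v hv h
    exact ⟨⟨y, hy⟩, rfl⟩
  · rintro ⟨⟨y, hy⟩, h⟩
    obtain rfl : x = π • y := congrArg Subtype.val h
    exact ⟨⟨_, toBaseChange_mem_inducedLattice K hF hπ hy⟩, map_smul _ _ _⟩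

theorem deformationToSlice_surjective :
    Function.Surjective (deformationToSlice G n K hF hπ) := by
  intro s
  obtain ⟨⟨v, hv⟩, rfl⟩ := Submodule.Quotient.mk_surjective _ s
  obtain ⟨x, hx, w, hw, rfl⟩ := (inducedLattice_properties K hF hπ hnoeth hM hG).2.2 v hv
  refine ⟨⟨x, hx⟩, ?_⟩
  change ModuleSlice.mk (deformedDoublyFiltered K hF hπ n) (inducedLattice G n K hF hπ) _ =
    ModuleSlice.mk (deformedDoublyFiltered K hF hπ n) (inducedLattice G n K hF hπ) _
  rw [← sub_eq_zero, ← map_sub, ModuleSlice.mk_eq_zero_iff]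
  refine ⟨-⟨w, hw⟩, ?_⟩
  change _ - (_ + π • w) = π • -w
  rw [smul_neg]
  abel

/-- The double filtration on `(U_n)^ ⊗ K ⊗_U M` induced by a good filtration of `M`. -/
def inducedDoubleFiltration (n : ℕ) : DoubleFiltration (deformedDoublyFiltered K hF hπ n)
    (BaseChange (toCompletedDeformation K hF hπ n) M) where
  L := inducedLattice G n K hF hπ
  isRLattice := (inducedLattice_properties K hF hπ hnoeth hM hG).1
  filt i := ((deformationFilt π G n i).submoduleOf (deformation π G n)).map
    (deformationToSlice G n K hF hπ)
  isModuleFiltration :=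
    have := hG.isModuleFiltration
    have hsmul : SetLike.GradedSMul (deformedDoublyFiltered K hF hπ n).filt
        (fun i ↦ ((deformationFilt π G n i).submoduleOf (deformation π G n)).map
          (deformationToSlice G n K hF hπ)) := by
      refine ⟨fun {i j a x} ha hx ↦ ?_⟩
      obtain ⟨u, hu, rfl⟩ := ha
      obtain ⟨⟨m, hm'⟩, hm, rfl⟩ := hx
      have := smul_mem_deformationFilt (G := G) hu hm
      exact ⟨⟨_, deformationFilt_le π G n _ this⟩, this,
        deformationToSlice_smul K hF hπ (G := G) u.2 hm' _⟩
    { toIsFiltration := IsFiltration.mk_int _ fun i j h ↦ Submodule.map_mono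
        (Submodule.comap_mono (deformationFilt_mono π G n h))
      toGradedSMul := hsmul }
  exhaustive x := by
    obtain ⟨⟨m, hm⟩, rfl⟩ := deformationToSlice_surjective K hF hπ hnoeth hM hG x
    obtain ⟨i, hi⟩ := exists_mem_deformationFilt π G n hm
    exact ⟨i, ⟨m, hm⟩, hi, rfl⟩

theorem inducedDoubleFiltration_isInduced :
    (inducedDoubleFiltration K hF hπ hnoeth hM hG n).IsInduced G := by
  refine ⟨rfl, fun i x ↦ ⟨?_, ?_⟩⟩
  · rintro ⟨⟨m, hm'⟩, hm, rfl⟩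
    exact ⟨m, hm, toBaseChange_mem_inducedLattice K hF hπ hm', rfl⟩
  · rintro ⟨m, hm, h, rfl⟩
    exact ⟨⟨m, deformationFilt_le π G n i hm⟩, hm, rfl⟩

/-- The map from `M_n` to the slice of the induced double filtration. -/
def inducedToSlice (n : ℕ) : deformation π G n →ₗ[R] ModuleSlice (deformedDoublyFiltered K hF hπ n)
    (inducedDoubleFiltration K hF hπ hnoeth hM hG n).L :=
  deformationToSlice G n K hF hπ

theorem inducedDoubleFiltration_isDeformationImage :
    IsDeformationImage π G n (inducedToSlice K hF hπ hnoeth hM hG n)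
      (inducedDoubleFiltration K hF hπ hnoeth hM hG n).filt where
  mono := hG.monotone
  eq_bot_of_neg := hG.eq_bot_of_neg
  mem_iff i s := by
    constructor
    · rintro ⟨⟨m, hm'⟩, hm, rfl⟩
      exact ⟨m, hm, rfl⟩
    · rintro ⟨m, hm, rfl⟩
      exact ⟨⟨m, deformationFilt_le π G n i hm⟩, hm, rfl⟩

theorem inducedToSlice_eq_zero_iff (x : deformation π G n) :
    inducedToSlice K hF hπ hnoeth hM hG n x = 0 ↔ ∃ y, x = π • y :=
  deformationToSlice_eq_zero_iff K hF hπ hnoeth hM hG x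

theorem inducedToSlice_smul {u : U} {x : M} (hu : u ∈ deformation π F n)
    (hx : x ∈ deformation π G n) (hux : u • x ∈ deformation π G n) :
    inducedToSlice K hF hπ hnoeth hM hG n ⟨u • x, hux⟩ =
      deformedAlgToSlice n K hF hπ ⟨u, hu⟩ • inducedToSlice K hF hπ hnoeth hM hG n ⟨x, hx⟩ :=
  deformationToSlice_smul K hF hπ hu hx hux

end InducedDoubleFiltration

/-! ### The isomorphisms between the graded objects, and goodness. -/

noncomputable section GradedIsomorphisms

section

variable {R : Type*} [CommRing R] {π : R} {X : Type*} [AddCommGroup X] [Module R X]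
  {G : ℤ → Submodule R X} {n₀ n : ℕ} {S₀ : Type*} [AddCommGroup S₀] [Module R S₀]
  {S : Type*} [AddCommGroup S] [Module R S]
  {σ₀ : deformation π G n₀ →ₗ[R] S₀} {E₀ : ℤ → Submodule R S₀}
  {σ : deformation π G n →ₗ[R] S} {E : ℤ → Submodule R S}

/-- Both graded modules are quotients of `gr X` by the same kernel. Compatibility with the two
surjections determines the isomorphism and yields its gradedness and its effect on symbols. -/
theorem IsDeformationImage.exists_equiv (hE₀ : IsDeformationImage π G n₀ σ₀ E₀)
    (hE : IsDeformationImage π G n σ E) (hX : ∀ x : X, π • x = 0 → x = 0)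
    (htors : ∀ m, n₀ ≤ m →
      ∀ i x, x ∈ G i → (∃ N : ℕ, π ^ N • x ∈ G (i - 1)) → π ^ m • x ∈ G (i - 1))
    (hker₀ : ∀ x, σ₀ x = 0 ↔ ∃ y, x = π • y) (hker : ∀ x, σ x = 0 ↔ ∃ y, x = π • y)
    (hn : n₀ ≤ n) :
    ∃ ε : Gr E₀ ≃ₗ[R] Gr E, (∀ x, ε (hE₀.grMap x) = hE.grMap x) ∧
      (∀ (i : ℤ) (a), ∃ b, ε (DirectSum.of _ i a) = DirectSum.of _ i b) ∧
      ∀ (i : ℕ) (x) (hx : x ∈ deformationFilt π G n₀ i),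
        ε (grSymbol E₀ i ⟨_, hE₀.map_mem hx⟩) =
          grSymbol E i ⟨_, hE.map_mem (pow_smul_mem_deformationFilt_of_le hn le_rfl hx)⟩ := by
  have h := LinearMap.equivOfKerEq_apply hE₀.grMap hE.grMap hE₀.grMap_surjective
    hE.grMap_surjective (hE₀.ker_grMap_eq hE hX htors hker₀ hker hn)
  refine ⟨LinearMap.equivOfKerEq hE₀.grMap hE.grMap hE₀.grMap_surjective hE.grMap_surjective
    (hE₀.ker_grMap_eq hE hX htors hker₀ hker hn), h, fun i a ↦ ?_, fun i x hx ↦ ?_⟩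
  · obtain ⟨y, rfl⟩ := hE₀.grPieceMap_surjective i a
    exact ⟨hE.grPieceMap i y, by rw [← hE₀.grMap_of, h, hE.grMap_of]⟩
  · obtain ⟨w, h₁, h₂⟩ := hE₀.exists_grMap_eq_symbols hE hn hx
    rw [h₁, h₂, h]

variable {U : Type*} [Ring U] [Algebra R U] {F : ℤ → Submodule R U}
  [IsRingFiltration F (fun i ↦ F (i - 1))] {M : Type*} [AddCommGroup M] [Module R M] [Module U M]
  [IsScalarTower R U M] {G : ℤ → Submodule R M}
  [IsModuleFiltration F (fun i ↦ F (i - 1)) G (fun i ↦ G (i - 1))]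
  {S₀ : Type*} [Ring S₀] [Algebra R S₀] {σ₀ : deformation π F n₀ →ₗ[R] S₀}
  {E₀ : ℤ → Submodule R S₀} [IsRingFiltration E₀ (fun i ↦ E₀ (i - 1))]
  {S : Type*} [Ring S] [Algebra R S] {σ : deformation π F n →ₗ[R] S}
  {E : ℤ → Submodule R S} [IsRingFiltration E (fun i ↦ E (i - 1))]
  {T₀ : Type*} [AddCommGroup T₀] [Module R T₀] [Module S₀ T₀] [IsScalarTower R S₀ T₀]
  {τ₀ : deformation π G n₀ →ₗ[R] T₀} {H₀ : ℤ → Submodule R T₀}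
  [IsModuleFiltration E₀ (fun i ↦ E₀ (i - 1)) H₀ (fun i ↦ H₀ (i - 1))]
  {T : Type*} [AddCommGroup T] [Module R T] [Module S T] [IsScalarTower R S T]
  {τ : deformation π G n →ₗ[R] T} {H : ℤ → Submodule R T}
  [IsModuleFiltration E (fun i ↦ E (i - 1)) H (fun i ↦ H (i - 1))]

/-- Every element upstairs comes from `gr U` or `gr M`, so multiplicativity and semilinearity are
inherited from the comparison maps. -/
theorem IsDeformationImage.exists_semilinear_equiv
    (hE₀ : IsDeformationImage π F n₀ σ₀ E₀) (hE : IsDeformationImage π F n σ E)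
    (hH₀ : IsDeformationImage π G n₀ τ₀ H₀) (hH : IsDeformationImage π G n τ H)
    (hmul₀ : ∀ a b, hE₀.grMap (a * b) = hE₀.grMap a * hE₀.grMap b)
    (hmul : ∀ a b, hE.grMap (a * b) = hE.grMap a * hE.grMap b)
    (hsmul₀ : ∀ (a : Gr F) (x : Gr G), hH₀.grMap (a • x) = hE₀.grMap a • hH₀.grMap x)
    (hsmul : ∀ (a : Gr F) (x : Gr G), hH.grMap (a • x) = hE.grMap a • hH.grMap x)
    (hU : ∀ x : U, π • x = 0 → x = 0) (hM : ∀ x : M, π • x = 0 → x = 0)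
    (htorsF : ∀ m, n₀ ≤ m →
      ∀ i x, x ∈ F i → (∃ N : ℕ, π ^ N • x ∈ F (i - 1)) → π ^ m • x ∈ F (i - 1))
    (htorsG : ∀ m, n₀ ≤ m →
      ∀ i x, x ∈ G i → (∃ N : ℕ, π ^ N • x ∈ G (i - 1)) → π ^ m • x ∈ G (i - 1))
    (hσ₀ : ∀ x, σ₀ x = 0 ↔ ∃ y, x = π • y) (hσ : ∀ x, σ x = 0 ↔ ∃ y, x = π • y)
    (hτ₀ : ∀ x, τ₀ x = 0 ↔ ∃ y, x = π • y) (hτ : ∀ x, τ x = 0 ↔ ∃ y, x = π • y)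
    (hn : n₀ ≤ n) :
    ∃ (ξ : Gr E₀ ≃+* Gr E) (μ : Gr H₀ ≃ₗ[R] Gr H),
      (∀ (r : R) (a), ξ (r • a) = r • ξ a) ∧
      (∀ (i : ℤ) (a), ∃ b, ξ (DirectSum.of _ i a) = DirectSum.of _ i b) ∧
      (∀ (i : ℕ) (x) (hx : x ∈ deformationFilt π F n₀ i),
        ξ (grSymbol E₀ i ⟨_, hE₀.map_mem hx⟩) =
          grSymbol E i ⟨_, hE.map_mem (pow_smul_mem_deformationFilt_of_le hn le_rfl hx)⟩) ∧
      (∀ (i : ℤ) (x), ∃ y, μ (DirectSum.of _ i x) = DirectSum.of _ i y) ∧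
      (∀ (i : ℕ) (x) (hx : x ∈ deformationFilt π G n₀ i),
        μ (grSymbol H₀ i ⟨_, hH₀.map_mem hx⟩) =
          grSymbol H i ⟨_, hH.map_mem (pow_smul_mem_deformationFilt_of_le hn le_rfl hx)⟩) ∧
      ∀ (a : Gr E₀) (x : Gr H₀), μ (a • x) = ξ a • μ x := by
  obtain ⟨ξ, hξ, hξ_graded, hξ_symbol⟩ := hE₀.exists_equiv hE hU htorsF hσ₀ hσ hn
  obtain ⟨μ, hμ, hμ_graded, hμ_symbol⟩ := hH₀.exists_equiv hH hM htorsG hτ₀ hτ hn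
  have hξ_mul (a b) : ξ (a * b) = ξ a * ξ b := by
    obtain ⟨a, rfl⟩ := hE₀.grMap_surjective a
    obtain ⟨b, rfl⟩ := hE₀.grMap_surjective b
    rw [← hmul₀, hξ, hξ, hξ, hmul]
  refine ⟨{ toEquiv := ξ.toEquiv, map_mul' := hξ_mul, map_add' := map_add ξ }, μ,
    map_smul ξ, hξ_graded, hξ_symbol, hμ_graded, hμ_symbol, fun a x ↦ ?_⟩
  change μ (a • x) = ξ a • μ x
  obtain ⟨a, rfl⟩ := hE₀.grMap_surjective a
  obtain ⟨x, rfl⟩ := hH₀.grMap_surjective x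
  rw [← hsmul₀, hμ, hμ, hξ, hsmul]

end

variable {R : Type*} [CommRing R] {π : R} {n : ℕ} [IsDomain R] [IsDiscreteValuationRing R]
  (K : Type*) [Field K] [Algebra R K] [IsFractionRing R K]
  {U : Type*} [Ring U] [Algebra R U]
  {F : ℤ → Submodule R U} [IsRingFiltration F (fun i ↦ F (i - 1))]
  {M : Type*} [AddCommGroup M] [Module R M] [Module U M] [IsScalarTower R U M]
  {G : ℤ → Submodule R M}
  (hF : IsDeformable F) (hπ : Irreducible π)

variable (n) in
/-- The surjection `gr U → Gr((U_n)^ ⊗ K)`. -/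
def deformedAlgGrHom : Gr F →+* Gr (deformedDoublyFiltered K hF hπ n).filt :=
  { (deformedAlg_isDeformationImage K hF hπ n).grMap.toAddMonoidHom with
    map_one' := (deformedAlg_isDeformationImage K hF hπ n).grMap_one
      fun _ ↦ map_one (toCompletedSlice π K (deformedAlg π F n))
    map_mul' := (deformedAlg_isDeformationImage K hF hπ n).grMap_mul
      fun x y hx hy _ ↦ map_mul (toCompletedSlice π K (deformedAlg π F n)) ⟨x, hx⟩ ⟨y, hy⟩ }

theorem deformedAlgGrHom_surjective : Function.Surjective (deformedAlgGrHom n K hF hπ) :=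
  (deformedAlg_isDeformationImage K hF hπ n).grMap_surjective

theorem deformedAlgToSlice_eq_zero_iff (x : deformation π F n) :
    deformedAlgToSlice n K hF hπ x = 0 ↔ ∃ y, x = π • y := by
  refine (toCompletedSlice_eq_zero_iff K hπ (hF.deformedAlg_torsionFree n hπ)
    (deformationToAlg π F n x)).trans ?_
  constructor
  · rintro ⟨y, hy⟩
    exact ⟨⟨y, y.2⟩, Subtype.ext (congrArg Subtype.val hy)⟩
  · rintro ⟨y, rfl⟩
    exact ⟨deformationToAlg π F n y, map_smul _ _ _⟩

variable (hnoeth : IsNoetherianRing (Gr F)) (hM : ∀ x : M, π • x = 0 → x = 0)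
  (hG : IsGoodFiltration F G)

theorem inducedDoubleFiltration_grMap_smul
    [IsModuleFiltration F (fun i ↦ F (i - 1)) G (fun i ↦ G (i - 1))] (a : Gr F) (x : Gr G) :
    (inducedDoubleFiltration_isDeformationImage K hF hπ hnoeth hM hG (n := n)).grMap (a • x) =
      deformedAlgGrHom n K hF hπ a •
        (inducedDoubleFiltration_isDeformationImage K hF hπ hnoeth hM hG (n := n)).grMap x :=
  (deformedAlg_isDeformationImage K hF hπ n).grMap_smul
    (inducedDoubleFiltration_isDeformationImage K hF hπ hnoeth hM hG)
    (fun _ _ hu hm hum ↦ inducedToSlice_smul K hF hπ hnoeth hM hG hu hm hum) a x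

theorem inducedDoubleFiltration_isGood :
    (inducedDoubleFiltration K hF hπ hnoeth hM hG n).IsGood := by
  have hE := inducedDoubleFiltration_isDeformationImage K hF hπ hnoeth hM hG (n := n)
  constructor
  · rw [eq_bot_iff]
    intro s hs
    -- The step of degree `-1` is already zero, which gives separatedness.
    obtain ⟨x, hx, rfl⟩ := (hE.mem_iff (-1) s).1 ((Submodule.mem_iInf _).1 hs (-1))
    rw [deformationFilt_of_neg (by norm_num), Submodule.mem_bot] at hx
    subst hx
    exact map_zero (inducedToSlice K hF hπ hnoeth hM hG n)
  · have := hG.isModuleFiltration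
    have := hG.finite_gr
    have : RingHomSurjective (deformedAlgGrHom n K hF hπ) := ⟨deformedAlgGrHom_surjective K hF hπ⟩
    -- Finite generation descends along the surjection from `gr M`, semilinear over the surjective
    -- ring map from `gr U`.
    let f : Gr G →ₛₗ[deformedAlgGrHom n K hF hπ]
        Gr (inducedDoubleFiltration K hF hπ hnoeth hM hG n).filt :=
      { hE.grMap.toAddMonoidHom with
        map_smul' := inducedDoubleFiltration_grMap_smul K hF hπ hnoeth hM hG }
    exact Module.Finite.of_surjective f hE.grMap_surjective

theorem deformedDoublyFiltered_isSymbol {i : ℕ} {u : U} (hu : u ∈ deformationFilt π F n i) :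
    (deformedDoublyFiltered K hF hπ n).IsSymbol i (toCompletedDeformation K hF hπ n u)
      (grSymbol _ i ⟨_, (deformedAlg_isDeformationImage K hF hπ n).map_mem hu⟩) := by
  rw [toCompletedDeformation_of_mem K hF hπ (deformationFilt_le π F n i hu)]
  exact ⟨⟨_, rfl⟩, (deformedAlg_isDeformationImage K hF hπ n).map_mem hu, rfl⟩

theorem inducedDoubleFiltration_isSymbol {i : ℕ} {x : M} (hx : x ∈ deformationFilt π G n i) :
    (inducedDoubleFiltration K hF hπ hnoeth hM hG n).IsSymbol i
      (toBaseChange (toCompletedDeformation K hF hπ n) M x) (grSymbol _ i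
        ⟨_, (inducedDoubleFiltration_isDeformationImage K hF hπ hnoeth hM hG).map_mem hx⟩) :=
  ⟨toBaseChange_mem_inducedLattice K hF hπ (deformationFilt_le π G n i hx),
    (inducedDoubleFiltration_isDeformationImage K hF hπ hnoeth hM hG).map_mem hx, rfl⟩

theorem inducedDoubleFiltration_exists_isomorphisms {n₀ : ℕ} (hn : n₀ ≤ n)
    (htorsG : ∀ m, n₀ ≤ m →
      ∀ i x, x ∈ G i → (∃ N : ℕ, π ^ N • x ∈ G (i - 1)) → π ^ m • x ∈ G (i - 1)) :
    ∃ (ξ : Gr (deformedDoublyFiltered K hF hπ n₀).filt ≃+*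
          Gr (deformedDoublyFiltered K hF hπ n).filt)
      (μ : Gr (inducedDoubleFiltration K hF hπ hnoeth hM hG n₀).filt ≃ₗ[R]
          Gr (inducedDoubleFiltration K hF hπ hnoeth hM hG n).filt),
      (∀ (r : R) (a), ξ (r • a) = r • ξ a) ∧
      (∀ (i : ℤ) (a), ∃ b, ξ (DirectSum.of _ i a) = DirectSum.of _ i b) ∧
      (∀ (i : ℕ), ∀ u ∈ deformationFilt π F n₀ i, ∃ s,
        (deformedDoublyFiltered K hF hπ n₀).IsSymbol i
          (toCompletedDeformation K hF hπ n₀ u) s ∧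
        (deformedDoublyFiltered K hF hπ n).IsSymbol i
          (toCompletedDeformation K hF hπ n (π ^ (i * (n - n₀)) • u)) (ξ s)) ∧
      (∀ (i : ℤ) (x), ∃ y, μ (DirectSum.of _ i x) = DirectSum.of _ i y) ∧
      (∀ (i : ℕ), ∀ m ∈ deformationFilt π G n₀ i, ∃ s,
        (inducedDoubleFiltration K hF hπ hnoeth hM hG n₀).IsSymbol i
          (toBaseChange (toCompletedDeformation K hF hπ n₀) M m) s ∧
        (inducedDoubleFiltration K hF hπ hnoeth hM hG n).IsSymbol i
          (toBaseChange (toCompletedDeformation K hF hπ n) M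
            (π ^ (i * (n - n₀)) • m)) (μ s)) ∧
      ∀ (a : Gr (deformedDoublyFiltered K hF hπ n₀).filt)
        (x : Gr (inducedDoubleFiltration K hF hπ hnoeth hM hG n₀).filt),
        μ (a • x) = ξ a • μ x := by
  have := hG.isModuleFiltration
  have hE (n : ℕ) := deformedAlg_isDeformationImage K hF hπ n
  have hH (n : ℕ) := inducedDoubleFiltration_isDeformationImage K hF hπ hnoeth hM hG (n := n)
  have htorsF (m : ℕ) (_ : n₀ ≤ m) (i : ℤ) (x : U) (hx : x ∈ F i)
      -- For the algebra there is no torsion at all, so the bound `n₀` found for `M` serves for `U`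
      -- as well.
      (h : ∃ N : ℕ, π ^ N • x ∈ F (i - 1)) : π ^ m • x ∈ F (i - 1) := by
    obtain ⟨N, h⟩ := h
    exact Submodule.smul_mem _ _ (hF.mem_of_pow_smul_mem hπ hx h)
  refine ((hE n₀).exists_semilinear_equiv (hE n) (hH n₀) (hH n)
    (map_mul (deformedAlgGrHom n₀ K hF hπ)) (map_mul (deformedAlgGrHom n K hF hπ))
    (inducedDoubleFiltration_grMap_smul K hF hπ hnoeth hM hG)
    (inducedDoubleFiltration_grMap_smul K hF hπ hnoeth hM hG) (hF.torsionFree hπ) hM htorsF htorsG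
    (deformedAlgToSlice_eq_zero_iff K hF hπ) (deformedAlgToSlice_eq_zero_iff K hF hπ)
    (inducedToSlice_eq_zero_iff K hF hπ hnoeth hM hG)
    (inducedToSlice_eq_zero_iff K hF hπ hnoeth hM hG) hn).imp
    fun ξ h ↦ h.imp fun μ h ↦ ⟨h.1, h.2.1, fun i u hu ↦
      ⟨_, deformedDoublyFiltered_isSymbol K hF hπ hu, ?_⟩, h.2.2.2.1, fun i m hm ↦
      ⟨_, inducedDoubleFiltration_isSymbol K hF hπ hnoeth hM hG hm, ?_⟩, h.2.2.2.2.2⟩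
  · rw [h.2.2.1 i u hu]
    exact deformedDoublyFiltered_isSymbol K hF hπ (pow_smul_mem_deformationFilt_of_le hn le_rfl hu)
  · rw [h.2.2.2.2.1 i m hm]
    exact inducedDoubleFiltration_isSymbol K hF hπ hnoeth hM hG
      (pow_smul_mem_deformationFilt_of_le hn le_rfl hm)

/-- The filtrations enter as variables tied to the induced ones by equations, so that the
conclusions transfer by substitution to any family equal to the induced one. -/
theorem exists_isomorphisms_of_eq_induced {n₀ : ℕ} (hn : n₀ ≤ n)
    (htorsG : ∀ m, n₀ ≤ m →
      ∀ i x, x ∈ G i → (∃ N : ℕ, π ^ N • x ∈ G (i - 1)) → π ^ m • x ∈ G (i - 1))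
    (D₀ : DoubleFiltration (deformedDoublyFiltered K hF hπ n₀)
      (BaseChange (toCompletedDeformation K hF hπ n₀) M))
    (D : DoubleFiltration (deformedDoublyFiltered K hF hπ n)
      (BaseChange (toCompletedDeformation K hF hπ n) M))
    (hD₀ : D₀ = inducedDoubleFiltration K hF hπ hnoeth hM hG n₀)
    (hD : D = inducedDoubleFiltration K hF hπ hnoeth hM hG n) :
    D.IsGood ∧ D.IsInduced G ∧
    ∃ (ξ : Gr (deformedDoublyFiltered K hF hπ n₀).filt ≃+*
          Gr (deformedDoublyFiltered K hF hπ n).filt)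
      (μ : Gr D₀.filt ≃ₗ[R] Gr D.filt),
      (∀ (r : R) (a), ξ (r • a) = r • ξ a) ∧
      (∀ (i : ℤ) (a), ∃ b, ξ (DirectSum.of _ i a) = DirectSum.of _ i b) ∧
      (∀ (i : ℕ), ∀ u ∈ deformationFilt π F n₀ i, ∃ s,
        (deformedDoublyFiltered K hF hπ n₀).IsSymbol i
          (toCompletedDeformation K hF hπ n₀ u) s ∧
        (deformedDoublyFiltered K hF hπ n).IsSymbol i
          (toCompletedDeformation K hF hπ n (π ^ (i * (n - n₀)) • u)) (ξ s)) ∧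
      (∀ (i : ℤ) (x), ∃ y, μ (DirectSum.of _ i x) = DirectSum.of _ i y) ∧
      (∀ (i : ℕ), ∀ m ∈ deformationFilt π G n₀ i, ∃ s,
        D₀.IsSymbol i
          (toBaseChange (toCompletedDeformation K hF hπ n₀) M m) s ∧
        D.IsSymbol i
          (toBaseChange (toCompletedDeformation K hF hπ n) M
            (π ^ (i * (n - n₀)) • m)) (μ s)) ∧
      ∀ (a : Gr (deformedDoublyFiltered K hF hπ n₀).filt) (x : Gr D₀.filt),
        μ (a • x) = ξ a • μ x := by
  subst hD₀ hD
  exact ⟨inducedDoubleFiltration_isGood K hF hπ hnoeth hM hG,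
    inducedDoubleFiltration_isInduced K hF hπ hnoeth hM hG,
    inducedDoubleFiltration_exists_isomorphisms K hF hπ hnoeth hM hG hn htorsG⟩

end GradedIsomorphisms

/-! ### The proposition. -/

theorem mainTheorem12
    {R : Type*} [CommRing R] [IsDomain R] [IsDiscreteValuationRing R]
    [IsAdicComplete (IsLocalRing.maximalIdeal R) R]
    (K : Type*) [Field K] [Algebra R K] [IsFractionRing R K] [CharZero K]
    (p : ℕ) [Fact p.Prime] [CharP (IsLocalRing.ResidueField R) p]
    (π : R) (hπ : Irreducible π)
    {U : Type*} [Ring U] [Algebra R U]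
    (F : ℤ → Submodule R U) [IsRingFiltration F (fun i ↦ F (i - 1))]
    (hF : IsDeformable F)
    (hcomm : ∀ x y : Gr F, x * y = y * x) (hnoeth : IsNoetherianRing (Gr F))
    (hsep : ⨅ i : ℕ, π ^ i • F 0 = ⊥)
    (M : Type*) [AddCommGroup M] [Module R M] [Module U M] [IsScalarTower R U M]
    [Module.Finite U M] (hM : ∀ m : M, π • m = 0 → m = 0) :
    (∃ G : ℤ → Submodule R M, IsGoodFiltration F G) ∧
    ∀ G : ℤ → Submodule R M, IsGoodFiltration F G →
      ∃ n₀ : ℕ, ∃ D : ∀ n : ℕ, n₀ ≤ n →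
          DoubleFiltration (deformedDoublyFiltered K hF hπ n)
            (BaseChange (toCompletedDeformation K hF hπ n) M),
        ∀ (n : ℕ) (hn : n₀ ≤ n),
          Module.Finite (CompletedAlg π K (deformedAlg π F n))
            (BaseChange (toCompletedDeformation K hF hπ n) M) ∧
          (D n hn).IsGood ∧ (D n hn).IsInduced G ∧
          ∃ (ξ : Gr (deformedDoublyFiltered K hF hπ n₀).filt ≃+*
                Gr (deformedDoublyFiltered K hF hπ n).filt)
            (μ : Gr (D n₀ le_rfl).filt ≃ₗ[R] Gr (D n hn).filt),
            (∀ (r : R) (a), ξ (r • a) = r • ξ a) ∧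
            (∀ (i : ℤ) (a), ∃ b, ξ (DirectSum.of _ i a) = DirectSum.of _ i b) ∧
            (∀ (i : ℕ), ∀ u ∈ deformationFilt π F n₀ i, ∃ s,
              (deformedDoublyFiltered K hF hπ n₀).IsSymbol i
                (toCompletedDeformation K hF hπ n₀ u) s ∧
              (deformedDoublyFiltered K hF hπ n).IsSymbol i
                (toCompletedDeformation K hF hπ n (π ^ (i * (n - n₀)) • u)) (ξ s)) ∧
            (∀ (i : ℤ) (x), ∃ y, μ (DirectSum.of _ i x) = DirectSum.of _ i y) ∧
            (∀ (i : ℕ), ∀ m ∈ deformationFilt π G n₀ i, ∃ s,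
              (D n₀ le_rfl).IsSymbol i
                (toBaseChange (toCompletedDeformation K hF hπ n₀) M m) s ∧
              (D n hn).IsSymbol i
                (toBaseChange (toCompletedDeformation K hF hπ n) M
                  (π ^ (i * (n - n₀)) • m)) (μ s)) ∧
            ∀ (a : Gr (deformedDoublyFiltered K hF hπ n₀).filt) (x : Gr (D n₀ le_rfl).filt),
              μ (a • x) = ξ a • μ x := by
  refine ⟨hF.exists_isGoodFiltration, fun G hG ↦ ?_⟩
  -- The integer `n₀` is the exponent from which powers of `π` kill all `π`-power torsion of `gr M`.
  refine (hG.exists_torsion_bound hnoeth π).imp fun n₀ hn₀ ↦ ?_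
  have hD : ∃ D : ∀ n : ℕ, n₀ ≤ n → DoubleFiltration (deformedDoublyFiltered K hF hπ n)
      (BaseChange (toCompletedDeformation K hF hπ n) M),
      ∀ n hn, D n hn = inducedDoubleFiltration K hF hπ hnoeth hM hG n :=
    ⟨fun n _ ↦ inducedDoubleFiltration K hF hπ hnoeth hM hG n, fun _ _ ↦ rfl⟩
  exact hD.imp fun D hD n hn ↦ And.intro
    (baseChange_finite (toCompletedDeformation K hF hπ n) (M := M))
    (exists_isomorphisms_of_eq_induced K hF hπ hnoeth hM hG hn hn₀
      (D n₀ le_rfl) (D n hn) (hD _ _) (hD _ _))
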